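/- Let $(M,L)$ be a Finsler manifold of dimension $n\ge 3$: $M$ is a smooth manifold and $L:TM\to\mathbb R$ is continuous, smooth and positive on the slit tangent bundle $\mathcal TM=TM\setminus 0$, positively homogeneous of degree one in the directional argument, and such that $g=$ the fibrewise Hessian of $\tfrac12L^2$ is positive definite on $\pi^{-1}(TM)$, the pullback of $TM$ by $\pi:\mathcal TM\to M$. Let $\eta(u)=(u,u)$, $\rho=d\pi:T\mathcal TM\to\pi^{-1}(TM)$, and let $\gamma:\pi^{-1}(TM)\to T\mathcal TM$ be the vertical lift. Let $\nabla$ be the Cartan connection of $(M,L)$, i.e. the linear connection on $\pi^{-1}(TM)$ that is regular ($T\mathcal TM$ is the direct sum of the vertical space $\ker\rho$ and the horizontal space $\{\xi:\nabla_\xi\eta=0\}$), satisfies $\nabla g=0$, and whose torsion $\mathbf T(\xi,\zeta)=\nabla_\xi\rho\zeta-\nabla_\zeta\rho\xi-\rho[\xi,\zeta]$ satisfies $\mathbf T(\beta X,\beta Y)=0$ and $g(\mathbf T(\gamma X,\beta Y),Z)=g(\mathbf T(\gamma X,\beta Z),Y)$, where $\beta$ is the inverse of $\rho$ restricted to the horizontal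 spaces. Here $W,X,Y,Z$ denote smooth sections of $\pi^{-1}(TM)$. Let $$R(X,Y)Z=-\nabla_{\beta X}\nabla_{\beta Y}Z+\nabla_{\beta Y}\nabla_{\beta X}Z+\nabla_{[\beta X,\beta Y]}Z$$ be the horizontal curvature, $Ric(X,Z)$ the trace of $Y\mapsto R(X,Y)Z$, $r$ the trace of $Ric$ with respect to $g$, $G(X,Y)Z=g(X,Z)Y-g(Y,Z)X$, and $$C=R-\frac{r}{n(n-1)}\,G$$ the concircular curvature tensor. Let $\overset{h}{\nabla}$ be the horizontal covariant derivative, $(\overset{h}{\nabla}A)(W,\dots)=(\nabla_{\beta W}A)(\dots)$. Suppose that $(M,L)$ is $R^h$-recurrent: $R$ is not identically zero, and $\overset{h}{\nabla}R=\lambda\otimes R$ for a smooth linear form $\lambda$ on $\pi^{-1}(TM)$ that is positively homogeneous of degree zero in the directional argument. Then $$\overset{h}{\nabla}C=\lambda\otimes C.$$ In particular, if $C$ is not identically zero, then $(M,L)$ is concircularly recurrent with the same recurrence form $\lambda$. -/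

import Mathlib

open Bundle Set
open scoped Manifold ContDiff

noncomputable section

namespace Finsler

variable {n : ℕ} {M : Type*} [TopologicalSpace M] [ChartedSpace (EuclideanSpace ℝ (Fin n)) M]
  [IsManifold (𝓡 n) ∞ M]

/-! ### The pullback bundle over the slit tangent bundle -/

/-- The set of nonzero tangent vectors: the slit tangent bundle, an open submanifold of `TM`. -/
def slit (n : ℕ) (M : Type*) [TopologicalSpace M] [ChartedSpace (EuclideanSpace ℝ (Fin n)) M]
    [IsManifold (𝓡 n) ∞ M] : Set (TangentBundle (𝓡 n) M) :=
  {u | u.2 ≠ 0}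

/-- The projection `π : TM → M` as a smooth map. -/
def proj (n : ℕ) (M : Type*) [TopologicalSpace M] [ChartedSpace (EuclideanSpace ℝ (Fin n)) M]
    [IsManifold (𝓡 n) ∞ M] : C^∞⟮(𝓡 n).tangent, TangentBundle (𝓡 n) M; 𝓡 n, M⟯ :=
  ⟨fun u => u.proj, contMDiff_proj _⟩

/-- The fibre of the pullback bundle `π⁻¹(TM)` at `u`, that is, `T_{π u} M`. -/
abbrev Fib (u : TangentBundle (𝓡 n) M) : Type :=
  (proj n M *ᵖ (TangentSpace (𝓡 n) : M → Type)) u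

instance (u : TangentBundle (𝓡 n) M) : AddCommGroup (Fib u) :=
  inferInstanceAs (AddCommGroup (TangentSpace (𝓡 n) u.proj))

instance (u : TangentBundle (𝓡 n) M) : IsTopologicalAddGroup (Fib u) :=
  inferInstanceAs (IsTopologicalAddGroup (TangentSpace (𝓡 n) u.proj))

instance (u : TangentBundle (𝓡 n) M) : ContinuousSMul ℝ (Fib u) :=
  inferInstanceAs (ContinuousSMul ℝ (TangentSpace (𝓡 n) u.proj))

/-- The tangent space of the manifold `TM` at `u`. -/
abbrev TT (u : TangentBundle (𝓡 n) M) : Type := TangentSpace (𝓡 n).tangent u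

/-- Sections of the pullback bundle. Only their restriction to the slit tangent bundle matters;
the values over the zero section are irrelevant everywhere below. -/
abbrev PiField (n : ℕ) (M : Type*) [TopologicalSpace M]
    [ChartedSpace (EuclideanSpace ℝ (Fin n)) M] [IsManifold (𝓡 n) ∞ M] : Type _ :=
  (u : TangentBundle (𝓡 n) M) → Fib u

/-- Vector fields on `TM` (again only their restriction to the slit tangent bundle matters). -/
abbrev VField (n : ℕ) (M : Type*) [TopologicalSpace M]
    [ChartedSpace (EuclideanSpace ℝ (Fin n)) M] [IsManifold (𝓡 n) ∞ M] : Type _ :=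
  (u : TangentBundle (𝓡 n) M) → TT u

/-- `X` is a `π`-vector field: a smooth section of the pullback bundle over the slit tangent
bundle. -/
def IsPiVectorField (X : PiField n M) : Prop :=
  ContMDiffOn (𝓡 n).tangent ((𝓡 n).tangent.prod 𝓘(ℝ, EuclideanSpace ℝ (Fin n))) ∞
    (fun u => TotalSpace.mk' (EuclideanSpace ℝ (Fin n)) u (X u)) (slit n M)

/-- The fundamental `π`-vector field, `u ↦ (u, u)`. -/
def eta : PiField n M := fun u => u.2

/-- The bundle morphism `ρ : T(TM) → π⁻¹(TM)`, given by `dπ`. -/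
def rho (u : TangentBundle (𝓡 n) M) : TT u →L[ℝ] Fib u :=
  mfderiv (𝓡 n).tangent (𝓡 n) (proj n M) u

/-- The bundle morphism `γ : π⁻¹(TM) → T(TM)`: the vertical lift at `u = (p, v)`, the derivative
at `v` of the inclusion `w ↦ (p, w)` of the fibre `T_p M` into `TM`. -/
def gamma (u : TangentBundle (𝓡 n) M) : Fib u →L[ℝ] TT u :=
  mfderiv 𝓘(ℝ, EuclideanSpace ℝ (Fin n)) (𝓡 n).tangent
    (fun w : EuclideanSpace ℝ (Fin n) => (⟨u.proj, w⟩ : TangentBundle (𝓡 n) M)) u.2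

/-! ### Finsler structures -/

/-- The metric defined by `L`: `g_u` is the second derivative at `v` of the function `½ L²`
on `T_p M`, where `u = (p, v)`. -/
def metric (L : TangentBundle (𝓡 n) M → ℝ) (u : TangentBundle (𝓡 n) M) :
    Fib u →L[ℝ] Fib u →L[ℝ] ℝ :=
  fderiv ℝ (fderiv ℝ (fun w : EuclideanSpace ℝ (Fin n) =>
    (1 / 2 : ℝ) * L (⟨u.proj, w⟩ : TangentBundle (𝓡 n) M) ^ 2)) u.2

/-- `(M, L)` is a Finsler manifold. -/
structure IsFinsler (L : TangentBundle (𝓡 n) M → ℝ) : Prop where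
  continuous : Continuous L
  smooth : ContMDiffOn (𝓡 n).tangent 𝓘(ℝ, ℝ) ∞ L (slit n M)
  pos : ∀ u ∈ slit n M, 0 < L u
  homogeneous : ∀ (p : M) (v : TangentSpace (𝓡 n) p) (t : ℝ), 0 < t →
    L ⟨p, t • v⟩ = t * L ⟨p, v⟩
  posDef : ∀ u ∈ slit n M, ∀ x : Fib u, x ≠ 0 → 0 < metric L u x x

/-! ### Connections on the pullback bundle -/

/-- The underlying map of a linear connection on the pullback bundle: `D σ u ξ` is `D_ξ σ` for
`ξ` tangent to `TM` at `u`. -/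
abbrev Conn (n : ℕ) (M : Type*) [TopologicalSpace M]
    [ChartedSpace (EuclideanSpace ℝ (Fin n)) M] [IsManifold (𝓡 n) ∞ M] : Type _ :=
  PiField n M → (u : TangentBundle (𝓡 n) M) → TT u →L[ℝ] Fib u

/-- `D` is a smooth linear connection on the pullback bundle over the slit tangent bundle. -/
structure IsLinearConnection (D : Conn n M) : Prop where
  isCovariantDerivativeOn : IsCovariantDerivativeOn (I := (𝓡 n).tangent)
    (V := fun u : TangentBundle (𝓡 n) M => Fib u) (EuclideanSpace ℝ (Fin n)) D (slit n M)
  smooth : ContMDiffCovariantDerivativeOn (I := (𝓡 n).tangent)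
    (V := fun u : TangentBundle (𝓡 n) M => Fib u) (EuclideanSpace ℝ (Fin n)) ∞ D (slit n M)

/-- The connection map `K : ξ ↦ D_ξ η`. -/
def connMap (D : Conn n M) (u : TangentBundle (𝓡 n) M) : TT u →L[ℝ] Fib u := D eta u

/-- The vertical space at `u`. -/
def vertical (u : TangentBundle (𝓡 n) M) : Submodule ℝ (TT u) := LinearMap.ker (rho u).toLinearMap

/-- The horizontal space at `u`. -/
def horizontal (D : Conn n M) (u : TangentBundle (𝓡 n) M) : Submodule ℝ (TT u) :=
  LinearMap.ker (connMap D u).toLinearMap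

/-- `D` is regular: the tangent space of `TM` at each nonzero `u` is the direct sum of the
vertical and the horizontal space. -/
def IsRegular (D : Conn n M) : Prop := ∀ u ∈ slit n M, IsCompl (vertical u) (horizontal D u)

/-- The horizontal map `β`, the inverse of the restriction of `ρ` to the horizontal space
(a linear isomorphism if `D` is regular and `u ≠ 0`). -/
def beta (D : Conn n M) (u : TangentBundle (𝓡 n) M) : Fib u →L[ℝ] TT u :=
  (horizontal D u).subtypeL ∘L ((rho u) ∘L (horizontal D u).subtypeL).inverse

/-- `γ X` as a vector field. -/
def gammaField (X : PiField n M) : VField n M := fun u => gamma u (X u)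

/-- `β X` as a vector field. -/
def betaField (D : Conn n M) (X : PiField n M) : VField n M := fun u => beta D u (X u)

/-- `D_ξ Y` for a vector field `ξ` on `TM`. -/
def along (D : Conn n M) (ξ : VField n M) (Y : PiField n M) : PiField n M := fun u => D Y u (ξ u)

/-- The classical torsion `D_ξ ρζ - D_ζ ρξ - ρ[ξ, ζ]`. -/
def torsion (D : Conn n M) (ξ ζ : VField n M) : PiField n M := fun u =>
  along D ξ (fun w => rho w (ζ w)) u - along D ζ (fun w => rho w (ξ w)) u
    - rho u (VectorField.mlieBracket (𝓡 n).tangent ξ ζ u)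

/-- The classical curvature `-D_ξ D_ζ Z + D_ζ D_ξ Z + D_{[ξ, ζ]} Z`, with the sign for which
`R = k G` (`G` as below) in a Riemannian manifold of constant curvature `k`. -/
def curvature (D : Conn n M) (ξ ζ : VField n M) (Z : PiField n M) : PiField n M := fun u =>
  - along D ξ (along D ζ Z) u + along D ζ (along D ξ Z) u
    + D Z u (VectorField.mlieBracket (𝓡 n).tangent ξ ζ u)

/-- The (h)h-torsion `Q(X, Y)`. -/
def torsionQ (D : Conn n M) (X Y : PiField n M) : PiField n M :=
  torsion D (betaField D X) (betaField D Y)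

/-- The (h)hv-torsion `T(X, Y)`. -/
def torsionT (D : Conn n M) (X Y : PiField n M) : PiField n M :=
  torsion D (gammaField X) (betaField D Y)

/-- `∇` is the Cartan connection of `(M, L)`: the regular connection that is metric, has
vanishing (h)h-torsion and a (h)hv-torsion with `g(T(X, Y), Z) = g(T(X, Z), Y)`. -/
structure IsCartanConnection (L : TangentBundle (𝓡 n) M → ℝ) (D : Conn n M) : Prop where
  isLinearConnection : IsLinearConnection D
  isRegular : IsRegular D
  metric_compat : ∀ Y Z : PiField n M, IsPiVectorField Y → IsPiVectorField Z →
    ∀ u ∈ slit n M, ∀ ξ : TT u,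
      mvfderiv (𝓡 n).tangent (fun w => metric L w (Y w) (Z w)) u ξ
        = metric L u (D Y u ξ) (Z u) + metric L u (Y u) (D Z u ξ)
  torsionQ_eq_zero : ∀ X Y : PiField n M, IsPiVectorField X → IsPiVectorField Y →
    ∀ u ∈ slit n M, torsionQ D X Y u = 0
  torsionT_symm : ∀ X Y Z : PiField n M, IsPiVectorField X → IsPiVectorField Y →
    IsPiVectorField Z → ∀ u ∈ slit n M,
      metric L u (torsionT D X Y u) (Z u) = metric L u (torsionT D X Z u) (Y u)

/-! ### Horizontal curvature, scalar curvature, concircular curvature -/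

/-- `π`-tensor fields of type `(1, 3)`, through their action on `π`-vector fields. -/
abbrev PiTensor (n : ℕ) (M : Type*) [TopologicalSpace M]
    [ChartedSpace (EuclideanSpace ℝ (Fin n)) M] [IsManifold (𝓡 n) ∞ M] : Type _ :=
  PiField n M → PiField n M → PiField n M → PiField n M

/-- The h-curvature tensor `R(X, Y) Z` of `D`. -/
def hCurvature (D : Conn n M) : PiTensor n M := fun X Y Z =>
  curvature D (betaField D X) (betaField D Y) Z

/-- The coordinate basis of `T_{π u} M` given by the preferred chart at `π u`. -/
def fibBasis (u : TangentBundle (𝓡 n) M) : Module.Basis (Fin n) ℝ (Fib u) :=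
  ((EuclideanSpace.basisFun (Fin n) ℝ).toBasis :
    Module.Basis (Fin n) ℝ (EuclideanSpace ℝ (Fin n)))

/-- The local section of the pullback bundle, defined and smooth near `u`, that extends the
`i`-th basis vector of the fibre at `u`. -/
def frame (u : TangentBundle (𝓡 n) M) (i : Fin n) : PiField n M :=
  FiberBundle.extend (E := fun w : TangentBundle (𝓡 n) M => Fib w)
    (EuclideanSpace ℝ (Fin n)) (fibBasis u i)

/-- The horizontal Ricci tensor `Ric(X, Z)`: the trace of `Y ↦ R(X, Y) Z`. -/
def ricci (D : Conn n M) (X Z : PiField n M) (u : TangentBundle (𝓡 n) M) : ℝ :=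
  ∑ k, (fibBasis u).coord k (hCurvature D X (frame u k) Z u)

/-- The matrix of `g_u` in the basis `fibBasis u`. -/
def gram (L : TangentBundle (𝓡 n) M → ℝ) (u : TangentBundle (𝓡 n) M) :
    Matrix (Fin n) (Fin n) ℝ :=
  Matrix.of fun i j => metric L u (fibBasis u i) (fibBasis u j)

/-- The horizontal scalar curvature `r`: the trace of `Ric` with respect to `g`. -/
def scalarCurvature (L : TangentBundle (𝓡 n) M → ℝ) (D : Conn n M)
    (u : TangentBundle (𝓡 n) M) : ℝ :=
  ∑ i, ∑ j, (gram L u)⁻¹ i j * ricci D (frame u i) (frame u j) u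

/-- `G(X, Y) Z = g(X, Z) Y - g(Y, Z) X`. -/
def tensorG (L : TangentBundle (𝓡 n) M → ℝ) : PiTensor n M := fun X Y Z u =>
  metric L u (X u) (Z u) • Y u - metric L u (Y u) (Z u) • X u

/-- The concircular curvature tensor `C = R - r / (n (n - 1)) G`. -/
def concircularCurvature (L : TangentBundle (𝓡 n) M → ℝ) (D : Conn n M) : PiTensor n M :=
  fun X Y Z u => hCurvature D X Y Z u
    - (scalarCurvature L D u / ((n : ℝ) * ((n : ℝ) - 1))) • tensorG L X Y Z u

/-- The h-covariant derivative of a `π`-tensor field `A`: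
`(∇ʰA)(W, X, Y, Z) = ∇_{βW} (A(X, Y) Z) - A(∇_{βW} X, Y) Z - A(X, ∇_{βW} Y) Z
- A(X, Y) ∇_{βW} Z`. -/
def hDeriv (D : Conn n M) (A : PiTensor n M) (W X Y Z : PiField n M) : PiField n M := fun u =>
  along D (betaField D W) (A X Y Z) u
    - A (along D (betaField D W) X) Y Z u
    - A X (along D (betaField D W) Y) Z u
    - A X Y (along D (betaField D W) Z) u

/-! ### Recurrence -/

/-- Scalar `π`-forms, as families of linear forms on the fibres. -/
abbrev PiForm (n : ℕ) (M : Type*) [TopologicalSpace M]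
    [ChartedSpace (EuclideanSpace ℝ (Fin n)) M] [IsManifold (𝓡 n) ∞ M] : Type _ :=
  (u : TangentBundle (𝓡 n) M) → Fib u →ₗ[ℝ] ℝ

/-- `lam` is a smooth scalar `π`-form on the slit tangent bundle, positively homogeneous of degree
zero in the directional argument. -/
structure IsRecurrenceForm (lam : PiForm n M) : Prop where
  smooth : ∀ X : PiField n M, IsPiVectorField X →
    ContMDiffOn (𝓡 n).tangent 𝓘(ℝ, ℝ) ∞ (fun u => lam u (X u)) (slit n M)
  homogeneous : ∀ (p : M) (v w : TangentSpace (𝓡 n) p) (t : ℝ), v ≠ 0 → 0 < t →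
    lam (⟨p, t • v⟩ : TangentBundle (𝓡 n) M) w = lam (⟨p, v⟩ : TangentBundle (𝓡 n) M) w

/-- The `π`-tensor field `A` vanishes. -/
def TensorVanishes (A : PiTensor n M) : Prop :=
  ∀ X Y Z : PiField n M, IsPiVectorField X → IsPiVectorField Y → IsPiVectorField Z →
    ∀ u ∈ slit n M, A X Y Z u = 0

/-- The identity `∇ʰA = lam ⊗ A` on the slit tangent bundle. -/
def SatisfiesRecurrence (D : Conn n M) (A : PiTensor n M) (lam : PiForm n M) : Prop :=
  ∀ W X Y Z : PiField n M, IsPiVectorField W → IsPiVectorField X → IsPiVectorField Y →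
    IsPiVectorField Z → ∀ u ∈ slit n M, hDeriv D A W X Y Z u = lam u (W u) • A X Y Z u

/-- `(M, L)`, with Cartan connection `D`, is `Rʰ`-recurrent with recurrence form `lam`. -/
structure IsRhRecurrent (D : Conn n M) (lam : PiForm n M) : Prop where
  form : IsRecurrenceForm lam
  recurrence : SatisfiesRecurrence D (hCurvature D) lam
  nonzero : ¬ TensorVanishes (hCurvature D)

/-- `(M, L)`, with Cartan connection `D`, is concircularly recurrent with recurrence form `lam`. -/
structure IsConcircularlyRecurrent (L : TangentBundle (𝓡 n) M → ℝ) (D : Conn n M)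
    (lam : PiForm n M) : Prop where
  form : IsRecurrenceForm lam
  recurrence : SatisfiesRecurrence D (concircularCurvature L D) lam
  nonzero : ¬ TensorVanishes (concircularCurvature L D)

end Finsler

end

/-! Since `∇g = 0`, the tensor `G` is horizontally parallel and traces commute with horizontal
differentiation. Contracting `∇R = λ ⊗ R` twice gives `dr(βW) = λ(W) r`, and the product rule turns
this into `∇C = λ ⊗ R - λ ⊗ (r / (n (n - 1))) G = λ ⊗ C`.

The work lies in justifying the contraction. The recurrence hypothesis speaks of sections smooth on
the whole slit bundle, while traces need local frames. Cut-offs (`SmoothNear.exists_global`) and the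
tensoriality of the h-curvature (`hCurvature_eq_curvTensor`) bridge the gap; tensoriality in turn
needs the smoothness of `β` (`IsRegular.contMDiffAt_beta`).

The scalar curvature is computed at each point in a basis belonging to that point. Basis
independence of the trace lets it be rewritten near `u` in one smooth frame
(`eventually_scalarCurvature_eq`). Let `Ω` be the matrix of the connection in this frame in the
direction `βW`. The Gram matrix `G` and the Ricci matrix `B` then satisfy `dG = ΩG + GΩᵀ` and `dB =
λB + ΩB + BΩᵀ` at `u`. In the derivative of `∑ (G⁻¹)ⁱʲ Bᵢⱼ` all terms with `Ω` cancel
(`sum_inv_mul_deriv`), which leaves the factor `λ(W)`. -/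

noncomputable section

namespace Finsler

/-! ### Linear algebra of traces and contractions -/

section

open Matrix

/-- The trace of the bilinear form `B` with respect to the bilinear form `g`, computed in the
basis `b`. -/
def metricTrace {n : ℕ} {V : Type*} [AddCommGroup V] [Module ℝ V] (b : Module.Basis (Fin n) ℝ V)
    (g B : V →ₗ[ℝ] V →ₗ[ℝ] ℝ) : ℝ :=
  ∑ i, ∑ j, (Matrix.of fun i j => g (b i) (b j))⁻¹ i j * B (b i) (b j)

theorem metricTrace_eq_trace {n : ℕ} {V : Type*} [AddCommGroup V] [Module ℝ V]
    (b : Module.Basis (Fin n) ℝ V) (g B : V →ₗ[ℝ] V →ₗ[ℝ] ℝ) :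
    metricTrace b g B =
      ((LinearMap.toMatrix₂ b b g)⁻¹ * (LinearMap.toMatrix₂ b b B)ᵀ).trace := by
  have h : (Matrix.of fun i j => g (b i) (b j)) = LinearMap.toMatrix₂ b b g := by
    ext i j
    rw [LinearMap.toMatrix₂_apply, Matrix.of_apply]
  rw [metricTrace, h]
  simp only [Matrix.trace, Matrix.diag, Matrix.mul_apply, Matrix.transpose_apply,
    LinearMap.toMatrix₂_apply]

/-- A change of basis `P` replaces the matrices of both forms by `Pᵀ · P`, and the factors cancel by
cyclicity of the trace. Nondegeneracy of `g` plays no role, because `Matrix.mul_inv_rev` also holds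
for the default inverse `0` of a singular matrix. -/
theorem metricTrace_basis_independent {n : ℕ} {V : Type*} [AddCommGroup V] [Module ℝ V]
    (b c : Module.Basis (Fin n) ℝ V) (g B : V →ₗ[ℝ] V →ₗ[ℝ] ℝ) :
    metricTrace b g B = metricTrace c g B := by
  rw [metricTrace_eq_trace, metricTrace_eq_trace, ← LinearMap.toMatrix₂_mul_basis_toMatrix b b c c g,
    ← LinearMap.toMatrix₂_mul_basis_toMatrix b b c c B]
  have h1 : b.toMatrix c * c.toMatrix b = 1 := b.toMatrix_mul_toMatrix_flip c
  have h2 : (b.toMatrix c)⁻¹ = c.toMatrix b := Matrix.inv_eq_right_inv h1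
  have h3 : ((b.toMatrix c)ᵀ)⁻¹ * (b.toMatrix c)ᵀ = 1 := by
    rw [← Matrix.transpose_nonsing_inv, h2, ← Matrix.transpose_mul, h1, Matrix.transpose_one]
  rw [Matrix.mul_inv_rev, Matrix.mul_inv_rev, Matrix.transpose_mul, Matrix.transpose_mul,
    Matrix.transpose_transpose, h2]
  generalize (LinearMap.toMatrix₂ b b g)⁻¹ = G
  generalize (LinearMap.toMatrix₂ b b B)ᵀ = C
  have h4 : c.toMatrix b * (G * ((b.toMatrix c)ᵀ)⁻¹) * ((b.toMatrix c)ᵀ * (C * b.toMatrix c)) =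
      c.toMatrix b * (G * ((((b.toMatrix c)ᵀ)⁻¹ * (b.toMatrix c)ᵀ) * (C * b.toMatrix c))) := by
    simp only [Matrix.mul_assoc]
  rw [h4, h3, Matrix.one_mul, Matrix.trace_mul_comm (c.toMatrix b), Matrix.mul_assoc,
    Matrix.mul_assoc, h1, Matrix.mul_one]

/-- The derivative of the trace `∑ Hⁱʲ Bᵢⱼ` for `H = G⁻¹`, when `G` and `B` change by an
infinitesimal change of basis `Ω` and `B` moreover by the factor `l`. -/
theorem sum_inv_mul_deriv {n : ℕ} {G H H' B Ω : Matrix (Fin n) (Fin n) ℝ} {l : ℝ}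
    (hGH : G * H = 1) (h : H' * G + H * (Ω * G + G * Ωᵀ) = 0) :
    ∑ i, ∑ j, (H' i j * B i j + H i j * (l • B + (Ω * B + B * Ωᵀ)) i j) =
      l * ∑ i, ∑ j, H i j * B i j := by
  have htr : ∀ A C : Matrix (Fin n) (Fin n) ℝ, ∑ i, ∑ j, A i j * C i j = (A * Cᵀ).trace := by
    intro A C
    simp only [Matrix.trace, Matrix.diag, Matrix.mul_apply, Matrix.transpose_apply]
  have hHG : H * G = 1 := mul_eq_one_comm.1 hGH
  -- Solve `h`, the derivative of `H G = 1`, for `H'` by multiplying with `H = G⁻¹` on the right.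
  have h1 : H' = - (H * Ω + Ωᵀ * H) := by
    have h2 : H' * G * H = - (H * (Ω * G + G * Ωᵀ) * H) := by
      rw [eq_neg_of_add_eq_zero_left h, Matrix.neg_mul]
    rw [Matrix.mul_assoc, hGH, Matrix.mul_one] at h2
    rw [h2, Matrix.mul_add, Matrix.add_mul]
    have h3 : H * (Ω * G) * H = H * Ω * (G * H) := by simp only [Matrix.mul_assoc]
    have h4 : H * (G * Ωᵀ) * H = (H * G) * (Ωᵀ * H) := by simp only [Matrix.mul_assoc]
    rw [h3, h4, hGH, hHG, Matrix.mul_one, Matrix.one_mul]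
  simp only [Finset.sum_add_distrib]
  rw [htr, htr, htr, h1]
  simp only [Matrix.transpose_add, Matrix.transpose_smul, Matrix.transpose_mul,
    Matrix.transpose_transpose, Matrix.mul_add, Matrix.add_mul, Matrix.neg_mul, Matrix.mul_smul,
    Matrix.trace_add, Matrix.trace_neg, Matrix.trace_smul, smul_eq_mul]
  -- By cyclicity, the two `Ω`-terms of `H'` are exactly those coming from `B`, with opposite sign.
  have h5 : (Ωᵀ * H * Bᵀ).trace = (H * (Bᵀ * Ωᵀ)).trace := by
    rw [Matrix.mul_assoc, Matrix.trace_mul_comm, Matrix.mul_assoc]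
  have h6 : (H * Ω * Bᵀ).trace = (H * (Ω * Bᵀ)).trace := by rw [Matrix.mul_assoc]
  rw [h5, h6]
  ring

/-- The contraction `(x, z) ↦ tr (y ↦ T x y z)`. -/
def ricciForm {V : Type*} [AddCommGroup V] [Module ℝ V]
    (T : V →ₗ[ℝ] V →ₗ[ℝ] V →ₗ[ℝ] V) : V →ₗ[ℝ] V →ₗ[ℝ] ℝ :=
  LinearMap.mk₂ ℝ (fun x z => LinearMap.trace ℝ V ((T x).flip z))
    (fun x x' z => by rw [← map_add]; congr 1; ext; simp)
    (fun c x z => by rw [← map_smul]; congr 1; ext; simp)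
    (fun x z z' => by rw [← map_add]; congr 1; ext; simp)
    (fun c x z => by rw [← map_smul]; congr 1; ext; simp)

theorem ricciForm_eq_sum {n : ℕ} {V : Type*} [AddCommGroup V] [Module ℝ V]
    (b : Module.Basis (Fin n) ℝ V) (T : V →ₗ[ℝ] V →ₗ[ℝ] V →ₗ[ℝ] V) (x z : V) :
    ricciForm T x z = ∑ k, b.repr (T x (b k) z) k := by
  simp only [ricciForm, LinearMap.mk₂_apply]
  rw [LinearMap.trace_eq_matrix_trace ℝ b]
  simp [Matrix.trace, LinearMap.toMatrix_apply]

/-- The derivation `Ω` applied to the middle slot and to the value cancel in the contraction. -/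
theorem sum_repr_comm {n : ℕ} {V : Type*} [AddCommGroup V] [Module ℝ V]
    (b : Module.Basis (Fin n) ℝ V) (T : V →ₗ[ℝ] V →ₗ[ℝ] V →ₗ[ℝ] V) (Ω : V →ₗ[ℝ] V) (x z : V) :
    ∑ k, b.repr (T x (Ω (b k)) z) k = ∑ k, b.repr (Ω (T x (b k) z)) k := by
  have h1 : ∑ k, b.repr (T x (Ω (b k)) z) k = LinearMap.trace ℝ V (((T x).flip z) * Ω) := by
    rw [LinearMap.trace_eq_matrix_trace ℝ b]
    simp [Matrix.trace, LinearMap.toMatrix_apply]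
  have h2 : ∑ k, b.repr (Ω (T x (b k) z)) k = LinearMap.trace ℝ V (Ω * ((T x).flip z)) := by
    rw [LinearMap.trace_eq_matrix_trace ℝ b]
    simp [Matrix.trace, LinearMap.toMatrix_apply]
  rw [h1, h2, LinearMap.trace_mul_comm]

/-- A positive definite bilinear form has an invertible Gram matrix. -/
theorem isUnit_gram_of_pos {n : ℕ} {V : Type*} [AddCommGroup V] [Module ℝ V]
    (b : Module.Basis (Fin n) ℝ V) (g : V →ₗ[ℝ] V →ₗ[ℝ] ℝ) (hg : ∀ x, x ≠ 0 → 0 < g x x) :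
    IsUnit (LinearMap.toMatrix₂ b b g) := by
  rw [← Matrix.mulVec_injective_iff_isUnit, ← Matrix.coe_mulVecLin,
    injective_iff_map_eq_zero]
  -- A vector `v` in the kernel of the Gram matrix gives `x` with `g x x = v ⬝ G v = 0`.
  intro v hv
  rw [Matrix.mulVecLin_apply] at hv
  by_contra hne
  have hx : b.equivFun.symm v ≠ 0 := fun h => hne (b.equivFun.symm.map_eq_zero_iff.1 h)
  have h1 : g (b.equivFun.symm v) (b.equivFun.symm v) =
      v ⬝ᵥ ((LinearMap.toMatrix₂ b b g) *ᵥ v) := by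
    simp only [Module.Basis.equivFun_symm_apply, dotProduct, Matrix.mulVec,
      LinearMap.toMatrix₂_apply, Finset.mul_sum, map_sum, map_smul, LinearMap.sum_apply,
      LinearMap.smul_apply, smul_eq_mul]
    rw [Finset.sum_comm]
    exact Finset.sum_congr rfl fun i _ => Finset.sum_congr rfl fun j _ => by ring
  have := hg _ hx
  rw [h1, hv, dotProduct_zero] at this
  exact lt_irrefl _ this

end

/-! ### Topology of the slit tangent bundle -/

open Filter Topology

variable {n : ℕ} {M : Type*} [TopologicalSpace M] [ChartedSpace (EuclideanSpace ℝ (Fin n)) M]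
  [IsManifold (𝓡 n) ∞ M]

/-- The model fibre. -/
abbrev Model (n : ℕ) : Type := EuclideanSpace ℝ (Fin n)

/-- In a trivialization the fibre coordinate is continuous, and it vanishes exactly on the zero
section because it is linear and injective on each fibre. -/
theorem isOpen_slit : IsOpen (slit n M) := by
  rw [isOpen_iff_mem_nhds]
  intro u hu
  let e := trivializationAt (Model n) (TangentSpace (𝓡 n) : M → Type) u.proj
  have hbase : u.proj ∈ e.baseSet := FiberBundle.mem_baseSet_trivializationAt' u.proj
  have hu' : u ∈ e.source := e.mem_source.2 hbase
  have key : ∀ w ∈ e.source, ((e w).2 = 0 ↔ w.2 = 0) := by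
    intro w hw
    have hb := e.mem_source.1 hw
    have : (e w).2 = e.continuousLinearEquivAt ℝ w.proj hb w.2 := rfl
    rw [this]
    exact (e.continuousLinearEquivAt ℝ w.proj hb).map_eq_zero_iff
  have h1 : ContinuousAt (fun w => (e w).2) u :=
    continuousAt_snd.comp (e.continuousOn.continuousAt (e.open_source.mem_nhds hu'))
  have h2 : (e u).2 ≠ 0 := fun h => hu ((key u hu').1 h)
  filter_upwards [h1.eventually_ne h2, e.open_source.mem_nhds hu'] with w hw hws
  exact fun h => hw ((key w hws).2 h)

theorem slit_mem_nhds {u : TangentBundle (𝓡 n) M} (hu : u ∈ slit n M) : slit n M ∈ 𝓝 u :=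
  isOpen_slit.mem_nhds hu

/-- Smooth bump functions on `TM`, used to globalize local sections, require `TM` to be Hausdorff.
Points over the same base point are separated inside one trivialization, other points by their
projections. -/
instance t2Space_tangentBundle [T2Space M] : T2Space (TangentBundle (𝓡 n) M) := by
  refine ⟨fun u v huv => ?_⟩
  by_cases h : u.proj = v.proj
  · let e := trivializationAt (Model n) (TangentSpace (𝓡 n) : M → Type) u.proj
    have hu : u ∈ e.source := e.mem_source.2 (FiberBundle.mem_baseSet_trivializationAt' u.proj)
    have hv : v ∈ e.source := e.mem_source.2 (h ▸ FiberBundle.mem_baseSet_trivializationAt' u.proj)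
    have hne : (⟨u, hu⟩ : e.source) ≠ ⟨v, hv⟩ := fun hh => huv (congrArg Subtype.val hh)
    obtain ⟨A, B, hA, hB, huA, hvB, hAB⟩ := t2_separation
      (fun hh => huv (e.injOn hu hv hh) : e u ≠ e v)
    refine ⟨e.source ∩ e ⁻¹' A, e.source ∩ e ⁻¹' B, e.continuousOn.isOpen_inter_preimage
      e.open_source hA, e.continuousOn.isOpen_inter_preimage e.open_source hB, ⟨hu, huA⟩,
      ⟨hv, hvB⟩, ?_⟩
    exact (hAB.preimage e).mono inter_subset_right inter_subset_right
  · obtain ⟨A, B, hA, hB, huA, hvB, hAB⟩ := t2_separation h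
    have hc : Continuous (fun u : TangentBundle (𝓡 n) M => u.proj) :=
      FiberBundle.continuous_proj _ _
    exact ⟨_, _, hA.preimage hc, hB.preimage hc, huA, hvB, hAB.preimage _⟩

/-! ### Locally smooth sections and cut-offs -/

/-- The section `X` of the pullback bundle is smooth in a neighbourhood of `u`. -/
def SmoothNear (X : PiField n M) (u : TangentBundle (𝓡 n) M) : Prop :=
  ∀ᶠ w in 𝓝 u, ContMDiffAt (𝓡 n).tangent ((𝓡 n).tangent.prod 𝓘(ℝ, Model n)) ∞
    (fun w => TotalSpace.mk' (Model n) w (X w)) w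

/-- The function `f` on the tangent bundle is smooth in a neighbourhood of `u`. -/
def SmoothFunNear (f : TangentBundle (𝓡 n) M → ℝ) (u : TangentBundle (𝓡 n) M) : Prop :=
  ∀ᶠ w in 𝓝 u, ContMDiffAt (𝓡 n).tangent 𝓘(ℝ, ℝ) ∞ f w

/-- The section `X` of the pullback bundle is differentiable at `u`. -/
def PiDiffAt (X : PiField n M) (u : TangentBundle (𝓡 n) M) : Prop :=
  MDifferentiableAt (𝓡 n).tangent ((𝓡 n).tangent.prod 𝓘(ℝ, Model n))
    (fun w => TotalSpace.mk' (Model n) w (X w)) u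

/-- The function `f` on the tangent bundle is differentiable at `u`. -/
def FunDiffAt (f : TangentBundle (𝓡 n) M → ℝ) (u : TangentBundle (𝓡 n) M) : Prop :=
  MDifferentiableAt (𝓡 n).tangent 𝓘(ℝ, ℝ) f u

variable {u : TangentBundle (𝓡 n) M} {X Y Z W : PiField n M} {f g : TangentBundle (𝓡 n) M → ℝ}

theorem SmoothNear.piDiffAt (h : SmoothNear X u) : PiDiffAt X u :=
  h.self_of_nhds.mdifferentiableAt (by simp)

theorem SmoothFunNear.funDiffAt (h : SmoothFunNear f u) : FunDiffAt f u :=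
  h.self_of_nhds.mdifferentiableAt (by simp)

/-- Smoothness on a neighbourhood is an open condition; hence identities proved pointwise under it
hold near `u` and may be differentiated. -/
theorem SmoothNear.eventually (h : SmoothNear X u) : ∀ᶠ w in 𝓝 u, SmoothNear X w :=
  eventually_eventually_nhds.2 h

theorem SmoothFunNear.eventually (h : SmoothFunNear f u) : ∀ᶠ w in 𝓝 u, SmoothFunNear f w :=
  eventually_eventually_nhds.2 h

theorem IsPiVectorField.smoothNear (h : IsPiVectorField X) (hu : u ∈ slit n M) :
    SmoothNear X u := by
  filter_upwards [slit_mem_nhds hu] with w hw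
  exact (h w hw).contMDiffAt (slit_mem_nhds hw)

theorem SmoothNear.add (hX : SmoothNear X u) (hY : SmoothNear Y u) : SmoothNear (X + Y) u := by
  filter_upwards [hX, hY] with w h1 h2
  exact ContMDiffAt.add_section h1 h2

theorem SmoothNear.smul (hf : SmoothFunNear f u) (hX : SmoothNear X u) :
    SmoothNear (f • X) u := by
  filter_upwards [hf, hX] with w h1 h2
  exact ContMDiffAt.smul_section h1 h2

theorem PiDiffAt.add (hX : PiDiffAt X u) (hY : PiDiffAt Y u) : PiDiffAt (X + Y) u :=
  mdifferentiableAt_add_section hX hY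

theorem PiDiffAt.neg (hX : PiDiffAt X u) : PiDiffAt (-X) u :=
  mdifferentiableAt_neg_section hX

theorem PiDiffAt.sub (hX : PiDiffAt X u) (hY : PiDiffAt Y u) : PiDiffAt (X - Y) u :=
  mdifferentiableAt_sub_section hX hY

theorem PiDiffAt.smul (hf : FunDiffAt f u) (hX : PiDiffAt X u) : PiDiffAt (f • X) u :=
  MDifferentiableAt.smul_section hf hX

/-- A section that is smooth near a point agrees near this point with a globally smooth one. -/
theorem SmoothNear.exists_global [T2Space M] (h : SmoothNear X u) :
    ∃ X' : PiField n M, IsPiVectorField X' ∧ ∀ᶠ w in 𝓝 u, X' w = X w := by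
  obtain ⟨U, hU, hUo, huU⟩ := eventually_nhds_iff.1 h
  obtain ⟨χ, hχ⟩ := (SmoothBumpFunction.nhds_basis_tsupport (I := (𝓡 n).tangent) u).mem_iff.1
    (hUo.mem_nhds huU)
  -- The bump function is supported where `X` is smooth and equals `1` near `u`.
  refine ⟨(χ : TangentBundle (𝓡 n) M → ℝ) • X, ?_, ?_⟩
  · refine ContMDiff.contMDiffOn ?_
    refine ContMDiffOn.smul_section_of_tsupport (u := U) χ.contMDiff.contMDiffOn hUo hχ.2 ?_
    exact fun w hw => (hU w hw).contMDiffWithinAt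
  · filter_upwards [χ.eventuallyEq_one] with w hw
    simp [hw]

/-- The vector field `ξ` on the tangent bundle is smooth in a neighbourhood of `u`. -/
def VSmoothNear (ξ : VField n M) (u : TangentBundle (𝓡 n) M) : Prop :=
  ∀ᶠ w in 𝓝 u, ContMDiffAt (𝓡 n).tangent ((𝓡 n).tangent.prod 𝓘(ℝ, Model n × Model n)) ∞
    (fun w => TotalSpace.mk' (Model n × Model n) w (ξ w)) w

/-- The vector field `ξ` on the tangent bundle is differentiable at `u`. -/
def VDiffAt (ξ : VField n M) (u : TangentBundle (𝓡 n) M) : Prop :=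
  MDifferentiableAt (𝓡 n).tangent ((𝓡 n).tangent.prod 𝓘(ℝ, Model n × Model n))
    (fun w => TotalSpace.mk' (Model n × Model n) w (ξ w)) u

/-! ### The connection on local sections -/

variable {D : Conn n M} {ξ ζ χ : VField n M} {L : TangentBundle (𝓡 n) M → ℝ} {lam : PiForm n M}

theorem VSmoothNear.vDiffAt (h : VSmoothNear ξ u) : VDiffAt ξ u :=
  h.self_of_nhds.mdifferentiableAt (by simp)

namespace IsLinearConnection

theorem map_add (hD : IsLinearConnection D) (hu : u ∈ slit n M) (hX : PiDiffAt X u)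
    (hY : PiDiffAt Y u) : D (X + Y) u = D X u + D Y u :=
  hD.isCovariantDerivativeOn.add hX hY hu

theorem map_smul (hD : IsLinearConnection D) (hu : u ∈ slit n M) (hf : FunDiffAt f u)
    (hX : PiDiffAt X u) :
    D (f • X) u = f u • D X u + (mvfderiv (𝓡 n).tangent f u).smulRight (X u) :=
  hD.isCovariantDerivativeOn.leibniz hX hf hu

theorem map_neg (hD : IsLinearConnection D) (hu : u ∈ slit n M) (hX : PiDiffAt X u) :
    D (-X) u = -D X u := by
  have := hD.isCovariantDerivativeOn.smul_const (-1 : ℝ) hX hu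
  rw [neg_one_smul] at this
  exact this.trans (neg_one_smul ℝ (D X u))

theorem map_sub (hD : IsLinearConnection D) (hu : u ∈ slit n M) (hX : PiDiffAt X u)
    (hY : PiDiffAt Y u) : D (X - Y) u = D X u - D Y u := by
  rw [sub_eq_add_neg, hD.map_add hu hX hY.neg, hD.map_neg hu hY, sub_eq_add_neg]

theorem congr (hD : IsLinearConnection D) (hu : u ∈ slit n M) (hX : PiDiffAt X u)
    (hXY : ∀ᶠ w in 𝓝 u, Y w = X w) : D Y u = D X u := by
  refine hD.isCovariantDerivativeOn.congr_of_eventuallyEq ?_ hX (slit_mem_nhds hu) hXY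
  refine MDifferentiableAt.congr_of_eventuallyEq hX ?_
  filter_upwards [hXY] with w hw
  rw [hw]

/-- The smoothness axiom of the connection concerns sections smooth on the whole slit bundle. A
cut-off of `X` is such a section, and locality carries the conclusion back to `X`. -/
theorem eventually_contMDiffAt [T2Space M] (hD : IsLinearConnection D) (hu : u ∈ slit n M)
    (hX : SmoothNear X u) :
    ∀ᶠ w in 𝓝 u, ContMDiffAt (𝓡 n).tangent
      ((𝓡 n).tangent.prod 𝓘(ℝ, (Model n × Model n) →L[ℝ] Model n)) ∞
      (fun w => TotalSpace.mk' (E := fun w : TangentBundle (𝓡 n) M => TT w →L[ℝ] Fib w)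
        ((Model n × Model n) →L[ℝ] Model n) w (D X w)) w := by
  obtain ⟨X', hX', hXX'⟩ := hX.exists_global
  have h := hD.smooth.contMDiff (σ := X') hX'
  filter_upwards [slit_mem_nhds hu, hX, eventually_eventually_nhds.2 hXX'] with w hw hXw hw'
  refine ((h w hw).contMDiffAt (slit_mem_nhds hw)).congr_of_eventuallyEq ?_
  filter_upwards [slit_mem_nhds hw, eventually_eventually_nhds.2 hw'] with v hv hv'
  rw [hD.congr hv ((hX'.smoothNear hv).piDiffAt) (hv'.mono fun _ h => h.symm)]

theorem smoothNear_along [T2Space M] (hD : IsLinearConnection D) (hu : u ∈ slit n M)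
    (hξ : VSmoothNear ξ u) (hX : SmoothNear X u) : SmoothNear (along D ξ X) u := by
  filter_upwards [hD.eventually_contMDiffAt hu hX, hξ] with w h1 h2
  exact ContMDiffAt.clm_bundle_apply h1 h2

end IsLinearConnection

/-! ### Smoothness of the horizontal map `β` -/

/-- In coordinates `eta` is the fibre component of the identity map of `TM`. -/
theorem smoothNear_eta (u : TangentBundle (𝓡 n) M) : SmoothNear eta u := by
  refine Eventually.of_forall fun u => ?_
  rw [contMDiffAt_section]
  have h := contMDiffAt_totalSpace (IB := 𝓡 n) (IM := (𝓡 n).tangent) (n := ∞)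
    (F := Model n) (E := (TangentSpace (𝓡 n) : M → Type))
    (f := fun u : TangentBundle (𝓡 n) M => u) (x₀ := u)
  exact (h.1 contMDiffAt_id).2

theorem contMDiffAt_inCoordinates_rho (u : TangentBundle (𝓡 n) M) :
    ContMDiffAt (𝓡 n).tangent 𝓘(ℝ, (Model n × Model n) →L[ℝ] Model n) ∞
      (fun w => ContinuousLinearMap.inCoordinates (Model n × Model n)
        (fun w : TangentBundle (𝓡 n) M => TT w) (Model n)
        (fun w : TangentBundle (𝓡 n) M => Fib w) u w u w (rho w)) u := by
  have h := ContMDiffAt.mfderiv_const (m := ∞) (n := ∞) (proj n M).contMDiff.contMDiffAt (x₀ := u)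
    (by simp)
  exact h

instance finiteDimensional_fib (u : TangentBundle (𝓡 n) M) : FiniteDimensional ℝ (Fib u) :=
  VectorBundle.finiteDimensional ℝ (Model n) (fun w : TangentBundle (𝓡 n) M => Fib w) u

instance t2Space_fib (u : TangentBundle (𝓡 n) M) : T2Space (Fib u) :=
  FiberBundle.t2Space (Model n) (fun w : TangentBundle (𝓡 n) M => Fib w) u

instance finiteDimensional_tt (u : TangentBundle (𝓡 n) M) : FiniteDimensional ℝ (TT u) :=
  VectorBundle.finiteDimensional ℝ (Model n × Model n) (fun w : TangentBundle (𝓡 n) M => TT w) u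

instance t2Space_tt (u : TangentBundle (𝓡 n) M) : T2Space (TT u) :=
  FiberBundle.t2Space (Model n × Model n) (fun w : TangentBundle (𝓡 n) M => TT w) u

/-- The pair `(ρ, K)` of bundle maps. -/
def rhoConn (D : Conn n M) (u : TangentBundle (𝓡 n) M) : TT u →L[ℝ] Fib u × Fib u :=
  (rho u).prod (connMap D u)

/-- The kernel of `(ρ, K)` is the intersection of the vertical and the horizontal space, which is
zero, and both sides have dimension `2n`. -/
theorem IsRegular.bijective_rhoConn (hD : IsRegular D) (hu : u ∈ slit n M) :
    Function.Bijective (rhoConn D u) := by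
  have hinj : Function.Injective (rhoConn D u).toLinearMap := by
    rw [← LinearMap.ker_eq_bot, eq_bot_iff]
    intro x hx
    have hx' : rho u x = 0 ∧ connMap D u x = 0 := by
      simpa [rhoConn, Prod.ext_iff] using hx
    have := (hD u hu).disjoint.le_bot (show x ∈ vertical u ⊓ horizontal D u from hx')
    exact this
  have hdim : Module.finrank ℝ (TT u) = Module.finrank ℝ (Fib u × Fib u) := by
    have h1 : Module.finrank ℝ (TT u) = Module.finrank ℝ (Model n × Model n) := rfl
    have h2 : Module.finrank ℝ (Fib u) = Module.finrank ℝ (Model n) := rfl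
    rw [h1, Module.finrank_prod, Module.finrank_prod, h2]
  exact ⟨hinj, (LinearMap.injective_iff_surjective_of_finrank_eq_finrank hdim).1 hinj⟩

theorem IsRegular.rho_subtype_bijective (hD : IsRegular D) (hu : u ∈ slit n M) :
    Function.Bijective ((rho u) ∘L (horizontal D u).subtypeL) := by
  have h := hD.bijective_rhoConn hu
  constructor
  · intro x y hxy
    refine Subtype.ext (h.1 ?_)
    exact Prod.ext hxy ((LinearMap.mem_ker.1 x.2).trans (LinearMap.mem_ker.1 y.2).symm)
  · intro y
    obtain ⟨x, hx⟩ := h.2 (y, 0)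
    exact ⟨⟨x, congrArg Prod.snd hx⟩, congrArg Prod.fst hx⟩

/-- `ContinuousLinearMap.inverse` is a true inverse only for an invertible map, so regularity is
what rules out the default value `0`. -/
theorem IsRegular.rho_beta (hD : IsRegular D) (hu : u ∈ slit n M) (x : Fib u) :
    rho u (beta D u x) = x := by
  let e := (LinearEquiv.ofBijective ((rho u) ∘L (horizontal D u).subtypeL).toLinearMap
    (hD.rho_subtype_bijective hu)).toContinuousLinearEquiv
  have he : (rho u) ∘L (horizontal D u).subtypeL = (e : horizontal D u →L[ℝ] Fib u) := by
    ext; rfl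
  have h2 : beta D u x = ((e.symm x : horizontal D u) : TT u) := by
    simp [beta, he]
  rw [h2]
  exact e.apply_symm_apply x

/-- No regularity is needed: `beta` takes values in the horizontal space by construction, even when
the inverse has its default value. -/
theorem connMap_beta (u : TangentBundle (𝓡 n) M) (x : Fib u) : connMap D u (beta D u x) = 0 :=
  LinearMap.mem_ker.1 (((rho u) ∘L (horizontal D u).subtypeL).inverse x).2

/-- A right inverse of the first component of a linear equivalence onto a product, with values in
the kernel of the second component, expressed in coordinates `a`, `b`. -/
theorem coordinates_section_eq {V F A B : Type*} [AddCommGroup V] [Module ℝ V] [TopologicalSpace V]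
    [AddCommGroup F] [Module ℝ F] [TopologicalSpace F] [AddCommGroup A] [Module ℝ A]
    [TopologicalSpace A] [AddCommGroup B] [Module ℝ B] [TopologicalSpace B]
    (a : F ≃L[ℝ] A) (b : V ≃L[ℝ] B) (r : V ≃L[ℝ] F × F) (β : F →L[ℝ] V)
    (hβ : ∀ x, r (β x) = (x, 0)) :
    (b : V →L[ℝ] B) ∘L β ∘L (a.symm : A →L[ℝ] F) =
      (((b.symm.trans r).trans (a.prodCongr a)).symm : A × A →L[ℝ] B) ∘L
        ContinuousLinearMap.inl ℝ A A := by
  refine ContinuousLinearMap.ext fun x => ?_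
  refine (((b.symm.trans r).trans (a.prodCongr a)).symm_apply_eq.2 ?_).symm
  simp [hβ]

theorem coordinates_prod_eq {V F A B : Type*} [AddCommGroup V] [Module ℝ V] [TopologicalSpace V]
    [AddCommGroup F] [Module ℝ F] [TopologicalSpace F] [AddCommGroup A] [Module ℝ A]
    [TopologicalSpace A] [AddCommGroup B] [Module ℝ B] [TopologicalSpace B]
    (a : F ≃L[ℝ] A) (b : V ≃L[ℝ] B) (r : V ≃L[ℝ] F × F) (ρ κ : V →L[ℝ] F)
    (hr : ∀ x, r x = (ρ x, κ x)) :
    (((b.symm.trans r).trans (a.prodCongr a)) : B →L[ℝ] A × A) =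
      ((a : F →L[ℝ] A) ∘L ρ ∘L (b.symm : B →L[ℝ] V)).prod
        ((a : F →L[ℝ] A) ∘L κ ∘L (b.symm : B →L[ℝ] V)) := by
  refine ContinuousLinearMap.ext fun x => ?_
  simp [hr]

/-- The map `(ρ, K)` in the coordinates given by the trivializations at `u`. -/
def rhoConnCoord (D : Conn n M) (u w : TangentBundle (𝓡 n) M) :
    (Model n × Model n) →L[ℝ] (Model n × Model n) :=
  (ContinuousLinearMap.inCoordinates (Model n × Model n)
    (fun w : TangentBundle (𝓡 n) M => TT w) (Model n)
    (fun w : TangentBundle (𝓡 n) M => Fib w) u w u w (rho w)).prod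
  (ContinuousLinearMap.inCoordinates (Model n × Model n)
    (fun w : TangentBundle (𝓡 n) M => TT w) (Model n)
    (fun w : TangentBundle (𝓡 n) M => Fib w) u w u w (connMap D w))

theorem contMDiffAt_rhoConnCoord [T2Space M] (hD' : IsLinearConnection D) (hu : u ∈ slit n M) :
    ContMDiffAt (𝓡 n).tangent 𝓘(ℝ, (Model n × Model n) →L[ℝ] (Model n × Model n)) ∞
      (rhoConnCoord D u) u := by
  have hφ := contMDiffAt_inCoordinates_rho u
  have hκ := (hD'.eventually_contMDiffAt hu (smoothNear_eta u)).self_of_nhds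
  rw [contMDiffAt_hom_bundle] at hκ
  -- The pairing is written with composition and sum so that the smoothness rules for these
  -- operations apply.
  have h : ∀ φ κ : (Model n × Model n) →L[ℝ] Model n, φ.prod κ =
      ContinuousLinearMap.inl ℝ (Model n) (Model n) ∘L φ +
        ContinuousLinearMap.inr ℝ (Model n) (Model n) ∘L κ := by
    intro φ κ
    ext x <;> simp
  have h2 : rhoConnCoord D u = fun w => ContinuousLinearMap.inl ℝ (Model n) (Model n) ∘L
      (ContinuousLinearMap.inCoordinates (Model n × Model n)
        (fun w : TangentBundle (𝓡 n) M => TT w) (Model n)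
        (fun w : TangentBundle (𝓡 n) M => Fib w) u w u w (rho w)) +
      ContinuousLinearMap.inr ℝ (Model n) (Model n) ∘L
      (ContinuousLinearMap.inCoordinates (Model n × Model n)
        (fun w : TangentBundle (𝓡 n) M => TT w) (Model n)
        (fun w : TangentBundle (𝓡 n) M => Fib w) u w u w (connMap D w)) :=
    funext fun w => h _ _
  rw [h2]
  exact (contMDiffAt_const.clm_comp hφ).add (contMDiffAt_const.clm_comp hκ.2)

/-- `β` is the inverse of `(ρ, K)` restricted to the first factor. In coordinates it is therefore
built by inverting an operator between fixed spaces, unlike in its definition, where the domain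
varies with the point. -/
theorem IsRegular.exists_rhoConnCoord_eq (hD : IsRegular D) {w : TangentBundle (𝓡 n) M}
    (hw : w ∈ slit n M)
    (h1 : w ∈ (trivializationAt (Model n) (fun w : TangentBundle (𝓡 n) M => Fib w) u).baseSet)
    (h2 : w ∈ (trivializationAt (Model n × Model n)
      (fun w : TangentBundle (𝓡 n) M => TT w) u).baseSet) :
    ∃ e : (Model n × Model n) ≃L[ℝ] (Model n × Model n),
      (e : (Model n × Model n) →L[ℝ] (Model n × Model n)) = rhoConnCoord D u w ∧
        ContinuousLinearMap.inCoordinates (Model n)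
          (fun w : TangentBundle (𝓡 n) M => Fib w) (Model n × Model n)
          (fun w : TangentBundle (𝓡 n) M => TT w) u w u w (beta D w) =
          (e.symm : (Model n × Model n) →L[ℝ] (Model n × Model n)) ∘L
            ContinuousLinearMap.inl ℝ (Model n) (Model n) := by
  let a := (trivializationAt (Model n)
    (fun w : TangentBundle (𝓡 n) M => Fib w) u).continuousLinearEquivAt ℝ w h1
  let b := (trivializationAt (Model n × Model n)
    (fun w : TangentBundle (𝓡 n) M => TT w) u).continuousLinearEquivAt ℝ w h2
  let r : TT w ≃L[ℝ] Fib w × Fib w := (LinearEquiv.ofBijective (rhoConn D w).toLinearMap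
    (hD.bijective_rhoConn hw)).toContinuousLinearEquiv
  refine ⟨(b.symm.trans r).trans (a.prodCongr a), ?_, ?_⟩
  · rw [coordinates_prod_eq a b r (rho w) (connMap D w) (fun x => rfl)]
    unfold rhoConnCoord
    rw [ContinuousLinearMap.inCoordinates_eq h2 h1, ContinuousLinearMap.inCoordinates_eq h2 h1]
  · rw [ContinuousLinearMap.inCoordinates_eq h1 h2]
    refine coordinates_section_eq a b r (beta D w) fun x => ?_
    exact Prod.ext (hD.rho_beta hw x) (connMap_beta w x)

/-- Inversion of operators is smooth at invertible ones, and `(ρ, K)` depends smoothly on the point.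
-/
theorem IsRegular.contMDiffAt_beta [T2Space M] (hD : IsRegular D) (hD' : IsLinearConnection D)
    (hu : u ∈ slit n M) :
    ContMDiffAt (𝓡 n).tangent
      ((𝓡 n).tangent.prod 𝓘(ℝ, Model n →L[ℝ] (Model n × Model n))) ∞
      (fun w => TotalSpace.mk' (E := fun w : TangentBundle (𝓡 n) M => Fib w →L[ℝ] TT w)
        (Model n →L[ℝ] (Model n × Model n)) w (beta D w)) u := by
  rw [contMDiffAt_hom_bundle]
  refine ⟨contMDiffAt_id, ?_⟩
  have hloc : ∀ᶠ w in 𝓝 u, w ∈ slit n M ∧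
      w ∈ (trivializationAt (Model n) (fun w : TangentBundle (𝓡 n) M => Fib w) u).baseSet ∧
      w ∈ (trivializationAt (Model n × Model n)
        (fun w : TangentBundle (𝓡 n) M => TT w) u).baseSet := by
    filter_upwards [slit_mem_nhds hu, (trivializationAt (Model n)
        (fun w : TangentBundle (𝓡 n) M => Fib w) u).open_baseSet.mem_nhds
      (FiberBundle.mem_baseSet_trivializationAt' u), (trivializationAt (Model n × Model n)
        (fun w : TangentBundle (𝓡 n) M => TT w) u).open_baseSet.mem_nhds
      (FiberBundle.mem_baseSet_trivializationAt' u)] with w h1 h2 h3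
    exact ⟨h1, h2, h3⟩
  have hinv : ContMDiffAt (𝓡 n).tangent 𝓘(ℝ, (Model n × Model n) →L[ℝ] (Model n × Model n)) ∞
      (fun w => (rhoConnCoord D u w).inverse) u := by
    obtain ⟨h0, h1, h2⟩ := hloc.self_of_nhds
    obtain ⟨e, he, -⟩ := hD.exists_rhoConnCoord_eq h0 h1 h2
    have h := contDiffAt_map_inverse (n := ∞) e
    rw [he] at h
    exact h.contMDiffAt.comp u (contMDiffAt_rhoConnCoord hD' hu)
  have hinl : ContMDiffAt (𝓡 n).tangent 𝓘(ℝ, Model n →L[ℝ] (Model n × Model n)) ∞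
      (fun w => (rhoConnCoord D u w).inverse ∘L ContinuousLinearMap.inl ℝ (Model n) (Model n))
      u :=
    hinv.clm_comp contMDiffAt_const
  refine hinl.congr_of_eventuallyEq ?_
  filter_upwards [hloc] with w hw
  obtain ⟨e, he, h⟩ := hD.exists_rhoConnCoord_eq hw.1 hw.2.1 hw.2.2
  rw [h, ← he, ContinuousLinearMap.inverse_equiv]

theorem IsRegular.vSmoothNear_beta [T2Space M] (hD : IsRegular D) (hD' : IsLinearConnection D)
    (hu : u ∈ slit n M) (hX : SmoothNear X u) : VSmoothNear (betaField D X) u := by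
  filter_upwards [slit_mem_nhds hu, hX] with w hw hXw
  exact ContMDiffAt.clm_bundle_apply (hD.contMDiffAt_beta hD' hw) hXw

/-! ### Regularity of the metric -/

theorem fderiv_fderiv_comp_equiv {E : Type*} [NormedAddCommGroup E] [NormedSpace ℝ E]
    (Q : E → ℝ) (A : E ≃L[ℝ] E) (v x y : E) :
    fderiv ℝ (fderiv ℝ (Q ∘ A)) v x y = fderiv ℝ (fderiv ℝ Q) (A v) (A x) (A y) := by
  have h1 : fderiv ℝ (Q ∘ A) = (A.symm.arrowCongr (ContinuousLinearEquiv.refl ℝ ℝ)) ∘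
      ((fderiv ℝ Q) ∘ A) := by
    funext w
    rw [A.comp_right_fderiv]
    ext z
    simp
  rw [h1, ContinuousLinearEquiv.comp_fderiv, A.comp_right_fderiv]
  simp

theorem contMDiffAt_fderiv_param {E G B H N : Type*} [NormedAddCommGroup E] [NormedSpace ℝ E]
    [NormedAddCommGroup G] [NormedSpace ℝ G] [NormedAddCommGroup B] [NormedSpace ℝ B]
    [TopologicalSpace H] {J : ModelWithCorners ℝ B H} [TopologicalSpace N] [ChartedSpace H N]
    [IsManifold J 1 N] {x₀ : N} {f : N → E → G} {g : N → E}
    (hf : ContMDiffAt (J.prod 𝓘(ℝ, E)) 𝓘(ℝ, G) ∞ (Function.uncurry f) (x₀, g x₀))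
    (hg : ContMDiffAt J 𝓘(ℝ, E) ∞ g x₀) :
    ContMDiffAt J 𝓘(ℝ, E →L[ℝ] G) ∞ (fun x => fderiv ℝ (f x) (g x)) x₀ := by
  refine (ContMDiffAt.mfderiv f g hf hg (by simp)).congr_of_eventuallyEq
    (Eventually.of_forall fun x => ?_)
  refine Eq.trans mfderiv_eq_fderiv.symm ?_
  exact (congrFun (inTangentCoordinates_model_space (I := 𝓘(ℝ, E)) (I' := 𝓘(ℝ, G)) g
    (fun x => f x (g x)) (fun x => mfderiv 𝓘(ℝ, E) 𝓘(ℝ, G) (f x) (g x)) x₀) x).symm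

/-- The trivialization of the tangent bundle of `M` around the base point of `u`. -/
abbrev baseTriv (u : TangentBundle (𝓡 n) M) :
    Trivialization (Model n) (TotalSpace.proj : TangentBundle (𝓡 n) M → M) :=
  trivializationAt (Model n) (TangentSpace (𝓡 n) : M → Type) u.proj

/-- The energy `½ L²` with the fibres parametrized by the trivialization around `u`. -/
def energyCoord (L : TangentBundle (𝓡 n) M → ℝ) (u w : TangentBundle (𝓡 n) M) (v : Model n) : ℝ :=
  (1 / 2 : ℝ) * L ((baseTriv u).toOpenPartialHomeomorph.symm (w.proj, v)) ^ 2

/-- The energy is smooth only off the zero section; the chosen point corresponds to `u` itself under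
the trivialization. -/
theorem IsFinsler.contMDiffAt_energyCoord (hL : IsFinsler L) (hu : u ∈ slit n M) :
    ContMDiffAt ((𝓡 n).tangent.prod 𝓘(ℝ, Model n)) 𝓘(ℝ, ℝ) ∞
      (Function.uncurry (energyCoord L u)) (u, (baseTriv u u).2) := by
  have hb : u.proj ∈ (baseTriv u).baseSet := FiberBundle.mem_baseSet_trivializationAt' u.proj
  have hpair : ContMDiffAt ((𝓡 n).tangent.prod 𝓘(ℝ, Model n)) ((𝓡 n).prod 𝓘(ℝ, Model n)) ∞
      (fun z : TangentBundle (𝓡 n) M × Model n => (z.1.proj, z.2)) (u, (baseTriv u u).2) :=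
    (((proj n M).contMDiff.contMDiffAt).comp _ contMDiffAt_fst).prodMk contMDiffAt_snd
  have hsymm : ContMDiffAt ((𝓡 n).prod 𝓘(ℝ, Model n)) (𝓡 n).tangent ∞
      (baseTriv u).toOpenPartialHomeomorph.symm (u.proj, (baseTriv u u).2) := by
    refine ((baseTriv u).contMDiffOn_symm (n := ∞) (IB := 𝓡 n)).contMDiffAt ?_
    exact (baseTriv u).open_target.mem_nhds ((baseTriv u).mem_target.2 hb)
  have hval : (baseTriv u).toOpenPartialHomeomorph.symm (u.proj, (baseTriv u u).2) = u := by
    rw [show (u.proj, (baseTriv u u).2) = baseTriv u u from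
      Prod.ext ((baseTriv u).coe_fst' hb).symm rfl]
    exact (baseTriv u).symm_apply_apply ((baseTriv u).mem_source.2 hb)
  have hLu : ContMDiffAt (𝓡 n).tangent 𝓘(ℝ, ℝ) ∞ L
      ((baseTriv u).toOpenPartialHomeomorph.symm (u.proj, (baseTriv u u).2)) := by
    rw [hval]
    exact (hL.smooth u hu).contMDiffAt (slit_mem_nhds hu)
  have h := hLu.comp (u.proj, (baseTriv u u).2) hsymm
  have h' := ContMDiffAt.comp (u, (baseTriv u u).2)
    (g := L ∘ (baseTriv u).toOpenPartialHomeomorph.symm) h hpair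
  exact contMDiffAt_const.mul (h'.pow 2)

theorem IsFinsler.contMDiffAt_hessian_energyCoord (hL : IsFinsler L) (hu : u ∈ slit n M) :
    ContMDiffAt (𝓡 n).tangent 𝓘(ℝ, Model n →L[ℝ] Model n →L[ℝ] ℝ) ∞
      (fun w => fderiv ℝ (fderiv ℝ (energyCoord L u w)) (baseTriv u w).2) u := by
  have hp : ContMDiffAt (((𝓡 n).tangent.prod 𝓘(ℝ, Model n)).prod 𝓘(ℝ, Model n))
      ((𝓡 n).tangent.prod 𝓘(ℝ, Model n)) ∞
      (fun z : (TangentBundle (𝓡 n) M × Model n) × Model n => (z.1.1, z.2))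
      ((u, (baseTriv u u).2), (baseTriv u u).2) :=
    (contMDiffAt_fst.comp _ contMDiffAt_fst).prodMk contMDiffAt_snd
  have hv : ContMDiffAt (𝓡 n).tangent 𝓘(ℝ, Model n) ∞ (fun w => (baseTriv u w).2) u :=
    ((contMDiffAt_totalSpace (IB := 𝓡 n) (IM := (𝓡 n).tangent) (n := ∞)
      (F := Model n) (E := (TangentSpace (𝓡 n) : M → Type))
      (f := fun u : TangentBundle (𝓡 n) M => u) (x₀ := u)).1 contMDiffAt_id).2
  refine contMDiffAt_fderiv_param (f := fun w v => fderiv ℝ (energyCoord L u w) v) ?_ hv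
  -- The inner derivative must be smooth jointly in `(w, v)`, so the fibre variable `v` joins the
  -- parameters before differentiating again.
  refine contMDiffAt_fderiv_param
    (f := fun z : TangentBundle (𝓡 n) M × Model n => energyCoord L u z.1)
    (g := fun z => z.2) ?_ contMDiffAt_snd
  exact ContMDiffAt.comp ((u, (baseTriv u u).2), (baseTriv u u).2)
    (g := Function.uncurry (energyCoord L u)) (hL.contMDiffAt_energyCoord hu) hp

/-- `metric` uses the identification of the fibre at `w` with the model space, the coordinate energy
that of the trivialization around `u`. The two differ by a linear isomorphism, under which Hessians
transform without extra terms. -/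
theorem metric_eq_hessian_energyCoord {w : TangentBundle (𝓡 n) M}
    (hw : w.proj ∈ (baseTriv u).baseSet) (x y : Fib w) :
    metric L w x y = fderiv ℝ (fderiv ℝ (energyCoord L u w)) (baseTriv u w).2
      ((baseTriv u).continuousLinearEquivAt ℝ w.proj hw x)
      ((baseTriv u).continuousLinearEquivAt ℝ w.proj hw y) := by
  let A : Model n ≃L[ℝ] Model n := ((baseTriv u).continuousLinearEquivAt ℝ w.proj hw).symm
  have hE : energyCoord L u w = (fun v : Model n =>
      (1 / 2 : ℝ) * L (⟨w.proj, v⟩ : TangentBundle (𝓡 n) M) ^ 2) ∘ A := by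
    funext v
    have : (⟨w.proj, A v⟩ : TangentBundle (𝓡 n) M) =
        (baseTriv u).toOpenPartialHomeomorph.symm (w.proj, v) :=
      (baseTriv u).mk_symm hw v
    simp only [energyCoord, Function.comp_apply]
    rw [this]
  rw [hE, fderiv_fderiv_comp_equiv]
  have h1 : A (baseTriv u w).2 = w.2 :=
    ((baseTriv u).continuousLinearEquivAt ℝ w.proj hw).symm_apply_apply w.2
  have h2 : ∀ x : Fib w, A ((baseTriv u).continuousLinearEquivAt ℝ w.proj hw x) = x := fun x =>
    ((baseTriv u).continuousLinearEquivAt ℝ w.proj hw).symm_apply_apply x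
  rw [h1, h2, h2]
  rfl

theorem IsFinsler.funDiffAt_metric (hL : IsFinsler L) (hu : u ∈ slit n M) (hX : PiDiffAt X u)
    (hY : PiDiffAt Y u) : FunDiffAt (fun w => metric L w (X w) (Y w)) u := by
  have hH := (hL.contMDiffAt_hessian_energyCoord hu).mdifferentiableAt (by simp)
  have hX' := (mdifferentiableAt_section (𝓡 n).tangent _).1 hX
  have hY' := (mdifferentiableAt_section (𝓡 n).tangent _).1 hY
  refine MDifferentiableAt.congr_of_eventuallyEq ((hH.clm_apply hX').clm_apply hY') ?_
  have hb : (fun w : TangentBundle (𝓡 n) M => w.proj) ⁻¹' (baseTriv u).baseSet ∈ 𝓝 u :=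
    (FiberBundle.continuous_proj _ _).continuousAt.preimage_mem_nhds
      ((baseTriv u).open_baseSet.mem_nhds <| FiberBundle.mem_baseSet_trivializationAt' u.proj)
  filter_upwards [hb] with w hw
  exact metric_eq_hessian_energyCoord hw (X w) (Y w)

/-- The metric is compatible with the connection also on sections defined locally. -/
theorem IsCartanConnection.mvfderiv_metric [T2Space M] {D : Conn n M}
    (hD : IsCartanConnection L D) (hu : u ∈ slit n M) (hX : SmoothNear X u)
    (hY : SmoothNear Y u) (ξ : TT u) :
    mvfderiv (𝓡 n).tangent (fun w => metric L w (X w) (Y w)) u ξ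
        = metric L u (D X u ξ) (Y u) + metric L u (X u) (D Y u ξ) := by
  obtain ⟨X', hX', hXX'⟩ := hX.exists_global
  obtain ⟨Y', hY', hYY'⟩ := hY.exists_global
  have h := hD.metric_compat X' Y' hX' hY' u hu ξ
  rw [hD.isLinearConnection.congr hu hX.piDiffAt hXX',
    hD.isLinearConnection.congr hu hY.piDiffAt hYY', hXX'.self_of_nhds, hYY'.self_of_nhds] at h
  rw [← h]
  have : (fun w => metric L w (X w) (Y w)) =ᶠ[𝓝 u] (fun w => metric L w (X' w) (Y' w)) := by
    filter_upwards [hXX', hYY'] with w h1 h2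
    rw [h1, h2]
  simp only [mvfderiv]
  rw [this.mfderiv_eq]
  rfl

/-! ### Lie brackets and directional derivatives -/

instance isManifold_minSmoothness_three :
    IsManifold (𝓡 n).tangent (minSmoothness ℝ 3) (TangentBundle (𝓡 n) M) := by
  rw [minSmoothness_of_isRCLikeNormedField]
  infer_instance

instance isManifold_minSmoothness_two :
    IsManifold (𝓡 n).tangent (minSmoothness ℝ 2) (TangentBundle (𝓡 n) M) := by
  rw [minSmoothness_of_isRCLikeNormedField]
  infer_instance

/-- The derivative of the function `f` in the direction of the vector field `ξ`. -/
def dirDeriv (ξ : VField n M) (f : TangentBundle (𝓡 n) M → ℝ) (w : TangentBundle (𝓡 n) M) : ℝ :=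
  mvfderiv (𝓡 n).tangent f w (ξ w)

theorem SmoothFunNear.dirDeriv (hf : SmoothFunNear f u) (hξ : VSmoothNear ξ u) :
    SmoothFunNear (dirDeriv ξ f) u := by
  filter_upwards [hf, hξ] with w hfw hξw
  have h1 := ContMDiffAt.mfderiv_const (m := ∞) hfw (by simp)
  have h2 := (contMDiffAt_section _).1 hξw
  refine (h1.clm_apply h2).congr_of_eventuallyEq ?_
  filter_upwards [(trivializationAt (Model n × Model n)
    (fun w : TangentBundle (𝓡 n) M => TT w) w).open_baseSet.mem_nhds
    (FiberBundle.mem_baseSet_trivializationAt' w)] with x hx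
  have h3 : (trivializationAt (Model n × Model n)
      (fun w : TangentBundle (𝓡 n) M => TT w) w).symmL ℝ x
      (trivializationAt (Model n × Model n)
        (fun w : TangentBundle (𝓡 n) M => TT w) w ⟨x, ξ x⟩).2 = ξ x := by
    rw [Trivialization.symmL_apply _ hx]
    exact Trivialization.symm_apply_apply_mk _ hx (ξ x)
  simp only [inTangentCoordinates, ContinuousLinearMap.inCoordinates]
  rw [TangentBundle.continuousLinearMapAt_model_space]
  refine Eq.symm ?_
  exact congrArg (mfderiv (𝓡 n).tangent 𝓘(ℝ, ℝ) f x) h3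

theorem VSmoothNear.smul (hf : SmoothFunNear f u) (hξ : VSmoothNear ξ u) :
    VSmoothNear (f • ξ) u := by
  filter_upwards [hf, hξ] with w h1 h2
  exact ContMDiffAt.smul_section h1 h2

theorem VSmoothNear.eventually (h : VSmoothNear ξ u) : ∀ᶠ w in 𝓝 u, VSmoothNear ξ w :=
  eventually_eventually_nhds.2 h

theorem VDiffAt.smul (hf : FunDiffAt f u) (h : VDiffAt ξ u) : VDiffAt (f • ξ) u :=
  MDifferentiableAt.smul_section hf h

/-- The Lie bracket of vector fields on the tangent bundle. -/
abbrev bracket (ξ ζ : VField n M) : VField n M := VectorField.mlieBracket (𝓡 n).tangent ξ ζ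

theorem bracket_swap : bracket ξ ζ u = - bracket ζ ξ u :=
  VectorField.mlieBracket_swap_apply

theorem bracket_smul_right (hf : FunDiffAt f u) (hζ : VDiffAt ζ u) :
    bracket ξ (f • ζ) u = dirDeriv ξ f u • ζ u + f u • bracket ξ ζ u :=
  VectorField.mlieBracket_smul_right hf hζ

theorem bracket_smul_left (hf : FunDiffAt f u) (hξ : VDiffAt ξ u) :
    bracket (f • ξ) ζ u = - dirDeriv ζ f u • ξ u + f u • bracket ξ ζ u :=
  VectorField.mlieBracket_smul_left hf hξ

theorem bracket_add_right (hζ : VDiffAt ζ u) (hχ : VDiffAt χ u) :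
    bracket ξ (ζ + χ) u = bracket ξ ζ u + bracket ξ χ u :=
  VectorField.mlieBracket_add_right hζ hχ

theorem bracket_add_left (hξ : VDiffAt ξ u) (hχ : VDiffAt χ u) :
    bracket (ξ + χ) ζ u = bracket ξ ζ u + bracket χ ζ u :=
  VectorField.mlieBracket_add_left hξ hχ

theorem bracket_congr_right {ζ' : VField n M} (h : ∀ᶠ w in 𝓝 u, ζ' w = ζ w) :
    bracket ξ ζ' u = bracket ξ ζ u :=
  (Filter.EventuallyEq.mlieBracket_vectorField (V₁ := ξ) (V := ξ) (EventuallyEq.refl _ _)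
    h).self_of_nhds

theorem bracket_congr_left {ξ' : VField n M} (h : ∀ᶠ w in 𝓝 u, ξ' w = ξ w) :
    bracket ξ' ζ u = bracket ξ ζ u :=
  (Filter.EventuallyEq.mlieBracket_vectorField (W₁ := ζ) (W := ζ) h
    (EventuallyEq.refl _ _)).self_of_nhds

theorem VSmoothNear.bracket (hξ : VSmoothNear ξ u) (hζ : VSmoothNear ζ u) :
    VSmoothNear (bracket ξ ζ) u := by
  have : IsManifold (𝓡 n).tangent (((⊤ : ℕ∞) : WithTop ℕ∞) + 1) (TangentBundle (𝓡 n) M) :=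
    inferInstanceAs (IsManifold (𝓡 n).tangent ∞ (TangentBundle (𝓡 n) M))
  filter_upwards [hξ, hζ] with w h1 h2
  exact ContMDiffAt.mlieBracket_vectorField (m := ⊤) (n := ⊤) h1 h2 (by simp)

theorem bracket_bracket (hξ : VSmoothNear ξ u) (hζ : VSmoothNear ζ u) (hχ : VSmoothNear χ u) :
    bracket ξ (bracket ζ χ) u = bracket (bracket ξ ζ) χ u + bracket ζ (bracket ξ χ) u :=
  have h : minSmoothness ℝ 2 ≤ ∞ := by
    rw [minSmoothness_of_isRCLikeNormedField]
    exact WithTop.coe_le_coe.2 (le_top : (2 : ℕ∞) ≤ ⊤)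
  VectorField.leibniz_identity_mlieBracket_apply (hξ.self_of_nhds.of_le h)
    (hζ.self_of_nhds.of_le h) (hχ.self_of_nhds.of_le h)

theorem exists_vSmoothNear (u : TangentBundle (𝓡 n) M) (v : TT u) :
    ∃ ξ : VField n M, VSmoothNear ξ u ∧ ξ u = v := by
  refine ⟨FiberBundle.extend (Model n × Model n) v, ?_, FiberBundle.extend_apply_self _ _⟩
  obtain ⟨s, hs, h⟩ := FiberBundle.exists_contMDiffOn_extend (𝓡 n).tangent (k := ∞)
    (Model n × Model n) (V := fun w : TangentBundle (𝓡 n) M => TT w) v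
  filter_upwards [eventually_mem_nhds_iff.2 hs] with w hw
  exact (h w (mem_of_mem_nhds hw)).contMDiffAt hw

theorem bracket_bracket_smul_right (hζ : VSmoothNear ζ u)
    (hχ : VSmoothNear χ u) (hf : SmoothFunNear f u) :
    bracket ξ (bracket ζ (f • χ)) u = dirDeriv ξ (dirDeriv ζ f) u • χ u +
      dirDeriv ζ f u • bracket ξ χ u + dirDeriv ξ f u • bracket ζ χ u +
      f u • bracket ξ (bracket ζ χ) u := by
  have h : ∀ᶠ w in 𝓝 u, bracket ζ (f • χ) w = (dirDeriv ζ f • χ + f • bracket ζ χ) w := by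
    filter_upwards [hχ.eventually, hf.eventually] with w h1 h2
    exact bracket_smul_right h2.funDiffAt h1.vDiffAt
  have h1 := (hf.dirDeriv hζ).funDiffAt
  rw [bracket_congr_right h, bracket_add_right (hχ.vDiffAt.smul h1)
    ((hζ.bracket hχ).vDiffAt.smul hf.funDiffAt), bracket_smul_right h1 hχ.vDiffAt,
    bracket_smul_right hf.funDiffAt (hζ.bracket hχ).vDiffAt]
  abel

/-- The Lie bracket acts on functions as a commutator. -/
theorem dirDeriv_bracket (hξ : VSmoothNear ξ u) (hζ : VSmoothNear ζ u) (hf : SmoothFunNear f u) :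
    dirDeriv (bracket ξ ζ) f u = dirDeriv ξ (dirDeriv ζ f) u - dirDeriv ζ (dirDeriv ξ f) u := by
  by_cases h0 : ∃ v : TT u, v ≠ 0
  · obtain ⟨v, hv⟩ := h0
    obtain ⟨χ, hχ, rfl⟩ := exists_vSmoothNear u v
    -- Expand the Jacobi identity for `ξ`, `ζ` and `f • χ`. After subtracting `f` times the identity
    -- for `χ`, the first-order terms cancel and only the desired difference times `χ u` remains,
    -- with `χ u ≠ 0`.
    have h1 := bracket_bracket hξ hζ (hχ.smul hf)
    rw [bracket_bracket_smul_right hζ hχ hf, bracket_bracket_smul_right hξ hχ hf,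
      bracket_smul_right hf.funDiffAt hχ.vDiffAt, bracket_bracket hξ hζ hχ] at h1
    have h2 : (dirDeriv (bracket ξ ζ) f u - (dirDeriv ξ (dirDeriv ζ f) u
        - dirDeriv ζ (dirDeriv ξ f) u)) • χ u = 0 := by
      rw [← sub_eq_zero] at h1
      rw [← neg_eq_zero, ← h1]
      module
    exact sub_eq_zero.1 ((smul_eq_zero.1 h2).resolve_right hv)
  -- If the tangent space is zero, every derivative is evaluated at the zero vector.
  · push Not at h0
    simp only [dirDeriv]
    rw [h0 (bracket ξ ζ u), h0 (ξ u), h0 (ζ u)]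
    simp

/-! ### Function-linearity of the curvature -/

theorem along_smul_left (D : Conn n M) (f : TangentBundle (𝓡 n) M → ℝ) (ξ : VField n M)
    (X : PiField n M) : along D (f • ξ) X = f • along D ξ X := by
  funext w
  exact (D X w).map_smul (f w) (ξ w)

theorem along_add_left (D : Conn n M) (ξ ζ : VField n M) (X : PiField n M) :
    along D (ξ + ζ) X = along D ξ X + along D ζ X := by
  funext w
  exact (D X w).map_add (ξ w) (ζ w)

namespace IsLinearConnection

theorem along_smul (hD : IsLinearConnection D) (hu : u ∈ slit n M) (hf : FunDiffAt f u)
    (hX : PiDiffAt X u) :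
    along D ξ (f • X) u = (f • along D ξ X + dirDeriv ξ f • X) u := by
  have h := DFunLike.congr_fun (hD.map_smul hu hf hX) (ξ u)
  exact h

theorem along_add (hD : IsLinearConnection D) (hu : u ∈ slit n M) (hX : PiDiffAt X u)
    (hY : PiDiffAt Y u) : along D ξ (X + Y) u = (along D ξ X + along D ξ Y) u :=
  DFunLike.congr_fun (hD.map_add hu hX hY) (ξ u)

theorem along_sub (hD : IsLinearConnection D) (hu : u ∈ slit n M) (hX : PiDiffAt X u)
    (hY : PiDiffAt Y u) : along D ξ (X - Y) u = along D ξ X u - along D ξ Y u :=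
  DFunLike.congr_fun (hD.map_sub hu hX hY) (ξ u)

theorem along_congr (hD : IsLinearConnection D) (hu : u ∈ slit n M) (hX : PiDiffAt X u)
    (hXY : ∀ᶠ w in 𝓝 u, Y w = X w) : along D ξ Y u = along D ξ X u :=
  DFunLike.congr_fun (hD.congr hu hX hXY) (ξ u)

end IsLinearConnection

theorem curvature_swap (D : Conn n M) (ξ ζ : VField n M) (Z : PiField n M)
    (u : TangentBundle (𝓡 n) M) : curvature D ζ ξ Z u = - curvature D ξ ζ Z u := by
  have h : D Z u (bracket ζ ξ u) = - D Z u (bracket ξ ζ u) := by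
    rw [bracket_swap, (D Z u).map_neg]
  simp only [curvature]
  rw [h]
  abel

theorem hCurvature_swap (D : Conn n M) (X Y Z : PiField n M) (u : TangentBundle (𝓡 n) M) :
    hCurvature D Y X Z u = - hCurvature D X Y Z u :=
  curvature_swap D _ _ Z u

theorem betaField_smul (D : Conn n M) (f : TangentBundle (𝓡 n) M → ℝ) (X : PiField n M) :
    betaField D (f • X) = f • betaField D X := by
  funext w
  exact (beta D w).map_smul (f w) (X w)

theorem betaField_add (D : Conn n M) (X Y : PiField n M) :
    betaField D (X + Y) = betaField D X + betaField D Y := by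
  funext w
  exact (beta D w).map_add (X w) (Y w)

/-- The derivative of `f` along `ζ` occurs twice, from the Leibniz rule and from the bracket, with
opposite signs. -/
theorem curvature_smul_left [T2Space M] (hD : IsLinearConnection D) (hu : u ∈ slit n M)
    (hf : SmoothFunNear f u) (hξ : VSmoothNear ξ u)
    (hZ : SmoothNear Z u) :
    curvature D (f • ξ) ζ Z u = f u • curvature D ξ ζ Z u := by
  have h1 : D Z u (bracket (f • ξ) ζ u) =
      - (dirDeriv ζ f u • along D ξ Z u) + f u • D Z u (bracket ξ ζ u) := by
    rw [bracket_smul_left hf.funDiffAt hξ.vDiffAt, (D Z u).map_add, neg_smul, (D Z u).map_neg,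
      (D Z u).map_smul, (D Z u).map_smul]
    rfl
  simp only [curvature]
  rw [h1, along_smul_left, along_smul_left,
    hD.along_smul hu hf.funDiffAt (hD.smoothNear_along hu hξ hZ).piDiffAt]
  simp only [Pi.add_apply, Pi.smul_apply']
  module

theorem curvature_add_left [T2Space M] {ξ' : VField n M}
    (hD : IsLinearConnection D) (hu : u ∈ slit n M) (hξ : VSmoothNear ξ u) (hξ' : VSmoothNear ξ' u)
    (hZ : SmoothNear Z u) :
    curvature D (ξ + ξ') ζ Z u = curvature D ξ ζ Z u + curvature D ξ' ζ Z u := by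
  have h1 : D Z u (bracket (ξ + ξ') ζ u) = D Z u (bracket ξ ζ u) + D Z u (bracket ξ' ζ u) := by
    rw [bracket_add_left hξ.vDiffAt hξ'.vDiffAt, (D Z u).map_add]
  simp only [curvature]
  rw [h1, along_add_left, along_add_left, hD.along_add hu (hD.smoothNear_along hu hξ hZ).piDiffAt
    (hD.smoothNear_along hu hξ' hZ).piDiffAt]
  simp only [Pi.add_apply]
  module

theorem along_along_smul [T2Space M] (hD : IsLinearConnection D) (hu : u ∈ slit n M)
    (hf : SmoothFunNear f u) (hζ : VSmoothNear ζ u)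
    (hZ : SmoothNear Z u) :
    along D ξ (along D ζ (f • Z)) u = f u • along D ξ (along D ζ Z) u +
      dirDeriv ξ f u • along D ζ Z u + dirDeriv ζ f u • along D ξ Z u +
        dirDeriv ξ (dirDeriv ζ f) u • Z u := by
  have h : ∀ᶠ w in 𝓝 u, along D ζ (f • Z) w = (f • along D ζ Z + dirDeriv ζ f • Z) w := by
    filter_upwards [slit_mem_nhds hu, hf.eventually, hZ.eventually] with w hw h1 h2
    exact hD.along_smul hw h1.funDiffAt h2.piDiffAt
  have h1 := (hf.dirDeriv hζ).funDiffAt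
  have h2 := (hD.smoothNear_along hu hζ hZ).piDiffAt
  rw [hD.along_congr hu ((h2.smul hf.funDiffAt).add (hZ.piDiffAt.smul h1)) h,
    hD.along_add hu (h2.smul hf.funDiffAt) (hZ.piDiffAt.smul h1), Pi.add_apply,
    hD.along_smul hu hf.funDiffAt h2, hD.along_smul hu h1 hZ.piDiffAt]
  simp only [Pi.add_apply, Pi.smul_apply']
  module

/-- The mixed first-order terms are symmetric in `ξ` and `ζ` and cancel; the second-order ones are
absorbed by `dirDeriv_bracket`. -/
theorem curvature_smul_right [T2Space M] (hD : IsLinearConnection D) (hu : u ∈ slit n M)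
    (hf : SmoothFunNear f u) (hξ : VSmoothNear ξ u)
    (hζ : VSmoothNear ζ u) (hZ : SmoothNear Z u) :
    curvature D ξ ζ (f • Z) u = f u • curvature D ξ ζ Z u := by
  have h1 : D (f • Z) u (bracket ξ ζ u) = f u • D Z u (bracket ξ ζ u) +
      (dirDeriv ξ (dirDeriv ζ f) u - dirDeriv ζ (dirDeriv ξ f) u) • Z u := by
    rw [← dirDeriv_bracket hξ hζ hf, hD.map_smul hu hf.funDiffAt hZ.piDiffAt]
    rfl
  simp only [curvature]
  rw [h1, along_along_smul hD hu hf hξ hZ, along_along_smul hD hu hf hζ hZ]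
  module

theorem along_along_add [T2Space M] {Z' : PiField n M}
    (hD : IsLinearConnection D) (hu : u ∈ slit n M) (hζ : VSmoothNear ζ u)
    (hZ : SmoothNear Z u) (hZ' : SmoothNear Z' u) :
    along D ξ (along D ζ (Z + Z')) u = along D ξ (along D ζ Z) u + along D ξ (along D ζ Z') u := by
  have h : ∀ᶠ w in 𝓝 u, along D ζ (Z + Z') w = (along D ζ Z + along D ζ Z') w := by
    filter_upwards [slit_mem_nhds hu, hZ'.eventually, hZ.eventually] with w hw h1 h2
    exact hD.along_add hw h2.piDiffAt h1.piDiffAt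
  have h2 := (hD.smoothNear_along hu hζ hZ).piDiffAt
  have h3 := (hD.smoothNear_along hu hζ hZ').piDiffAt
  rw [hD.along_congr hu (h2.add h3) h, hD.along_add hu h2 h3]
  rfl

theorem curvature_add_right [T2Space M] {Z' : PiField n M}
    (hD : IsLinearConnection D) (hu : u ∈ slit n M) (hξ : VSmoothNear ξ u)
    (hζ : VSmoothNear ζ u) (hZ : SmoothNear Z u) (hZ' : SmoothNear Z' u) :
    curvature D ξ ζ (Z + Z') u = curvature D ξ ζ Z u + curvature D ξ ζ Z' u := by
  have h1 : D (Z + Z') u (bracket ξ ζ u) = D Z u (bracket ξ ζ u) + D Z' u (bracket ξ ζ u) := by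
    rw [hD.map_add hu hZ.piDiffAt hZ'.piDiffAt]
    rfl
  simp only [curvature]
  rw [h1, along_along_add hD hu hξ hZ hZ', along_along_add hD hu hζ hZ hZ']
  module

theorem curvature_congr_right [T2Space M] {Z' : PiField n M}
    (hD : IsLinearConnection D) (hu : u ∈ slit n M) (hξ : VSmoothNear ξ u)
    (hζ : VSmoothNear ζ u) (hZ : SmoothNear Z u) (h : ∀ᶠ w in 𝓝 u, Z' w = Z w) :
    curvature D ξ ζ Z' u = curvature D ξ ζ Z u := by
  have h0 : ∀ χ : VField n M, ∀ᶠ w in 𝓝 u, along D χ Z' w = along D χ Z w := by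
    intro χ
    filter_upwards [slit_mem_nhds hu, hZ.eventually, eventually_eventually_nhds.2 h] with w hw h1 h2
    exact hD.along_congr hw h1.piDiffAt h2
  simp only [curvature]
  rw [hD.along_congr hu (hD.smoothNear_along hu hζ hZ).piDiffAt (h0 ζ),
    hD.along_congr hu (hD.smoothNear_along hu hξ hZ).piDiffAt (h0 ξ),
    hD.congr hu hZ.piDiffAt h]

theorem curvature_congr_left [T2Space M] {ξ' : VField n M}
    (hD : IsLinearConnection D) (hu : u ∈ slit n M) (hξ : VSmoothNear ξ u)
    (hZ : SmoothNear Z u) (h : ∀ᶠ w in 𝓝 u, ξ' w = ξ w) :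
    curvature D ξ' ζ Z u = curvature D ξ ζ Z u := by
  have h0 : ∀ᶠ w in 𝓝 u, along D ξ' Z w = along D ξ Z w := by
    filter_upwards [h] with w hw
    exact congrArg (D Z w) hw
  have h1 : D Z u (bracket ξ' ζ u) = D Z u (bracket ξ ζ u) := by
    rw [bracket_congr_left h]
  have h2 : ∀ V, along D ξ' V u = along D ξ V u := fun V => congrArg (D V u) h.self_of_nhds
  simp only [curvature]
  rw [h1, h2, hD.along_congr hu (hD.smoothNear_along hu hξ hZ).piDiffAt h0]

theorem piDiffAt_curvature [T2Space M] (hD : IsLinearConnection D) (hu : u ∈ slit n M)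
    (hξ : VSmoothNear ξ u) (hζ : VSmoothNear ζ u) (hZ : SmoothNear Z u) :
    PiDiffAt (curvature D ξ ζ Z) u := by
  have h1 := (hD.smoothNear_along hu hξ (hD.smoothNear_along hu hζ hZ)).piDiffAt
  have h2 := (hD.smoothNear_along hu hζ (hD.smoothNear_along hu hξ hZ)).piDiffAt
  have h3 := (hD.smoothNear_along hu (hξ.bracket hζ) hZ).piDiffAt
  exact (h1.neg.add h2).add h3

/-! ### Local frames -/

/-- The trivialization of the pullback bundle around `u`. -/
abbrev fibTriv (u : TangentBundle (𝓡 n) M) :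
    Trivialization (Model n)
      (TotalSpace.proj : TotalSpace (Model n) (fun w : TangentBundle (𝓡 n) M => Fib w) →
        TangentBundle (𝓡 n) M) :=
  trivializationAt (Model n) (fun w : TangentBundle (𝓡 n) M => Fib w) u

theorem mem_fibTriv (u : TangentBundle (𝓡 n) M) : u ∈ (fibTriv u).baseSet :=
  FiberBundle.mem_baseSet_trivializationAt' u

/-- The basis of the model fibre corresponding to `fibBasis u` in the trivialization around `u`. -/
def modelBasis (u : TangentBundle (𝓡 n) M) : Module.Basis (Fin n) ℝ (Model n) :=
  (fibBasis u).map ((fibTriv u).continuousLinearEquivAt ℝ u (mem_fibTriv u)).toLinearEquiv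

/-- The frame `frame u` as a basis of the fibre at `w`, for `w` near `u`. -/
def frameBasis (u : TangentBundle (𝓡 n) M) {w : TangentBundle (𝓡 n) M}
    (hw : w ∈ (fibTriv u).baseSet) : Module.Basis (Fin n) ℝ (Fib w) :=
  (fibTriv u).basisAt (modelBasis u) hw

theorem frame_eq_localFrame {w : TangentBundle (𝓡 n) M}
    (hw : w ∈ (fibTriv u).baseSet) (i : Fin n) :
    frame u i w = (fibTriv u).localFrame (modelBasis u) i w := by
  rw [Trivialization.localFrame_apply_of_mem_baseSet _ _ hw]
  rfl

theorem frame_self (u : TangentBundle (𝓡 n) M) (i : Fin n) : frame u i u = fibBasis u i :=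
  FiberBundle.extend_apply_self _ _

theorem eventually_mem_fibTriv (u : TangentBundle (𝓡 n) M) :
    ∀ᶠ w in 𝓝 u, w ∈ (fibTriv u).baseSet :=
  (fibTriv u).open_baseSet.mem_nhds (mem_fibTriv u)

theorem smoothNear_frame (u : TangentBundle (𝓡 n) M) (i : Fin n) : SmoothNear (frame u i) u := by
  obtain ⟨s, hs, h⟩ := FiberBundle.exists_contMDiffOn_extend (𝓡 n).tangent (k := ∞)
    (Model n) (V := fun w : TangentBundle (𝓡 n) M => Fib w) (fibBasis u i)
  filter_upwards [eventually_mem_nhds_iff.2 hs] with w hw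
  exact (h w (mem_of_mem_nhds hw)).contMDiffAt hw

/-- The coefficients of a section with respect to the frame `frame u`. -/
def frameCoeff (u : TangentBundle (𝓡 n) M) (i : Fin n) (w : TangentBundle (𝓡 n) M) :
    Fib w →ₗ[ℝ] ℝ :=
  (fibTriv u).localFrameCoeff (𝓡 n).tangent (modelBasis u) i w

theorem SmoothNear.frameCoeff (hX : SmoothNear X u) (i : Fin n) :
    SmoothFunNear (fun w => frameCoeff u i w (X w)) u := by
  filter_upwards [hX, eventually_mem_fibTriv u] with w hw hwu
  exact contMDiffAt_localFrameCoeff (modelBasis u) hwu hw i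

theorem PiDiffAt.frameCoeff (hX : PiDiffAt X u) (i : Fin n) :
    FunDiffAt (fun w => frameCoeff u i w (X w)) u :=
  mdifferentiableAt_localFrameCoeff (modelBasis u) (mem_fibTriv u) hX i

theorem eventually_eq_sum_frameCoeff (u : TangentBundle (𝓡 n) M) (X : PiField n M) :
    ∀ᶠ w in 𝓝 u, X w = (∑ i, (fun w => frameCoeff u i w (X w)) • frame u i) w := by
  filter_upwards [(fibTriv u).eventually_eq_localFrame_sum_coeff_smul (I := (𝓡 n).tangent)
    (s := X) (modelBasis u) (mem_fibTriv u), eventually_mem_fibTriv u] with w h1 h2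
  rw [Finset.sum_apply]
  refine h1.trans (Finset.sum_congr rfl fun i _ => ?_)
  exact congrArg (fun y => Finsler.frameCoeff u i w (X w) • y) (frame_eq_localFrame h2 i).symm

theorem frameCoeff_eq_repr {w : TangentBundle (𝓡 n) M} (hw : w ∈ (fibTriv u).baseSet)
    (i : Fin n) (x : Fib w) : frameCoeff u i w x = (frameBasis u hw).repr x i := by
  have h := (fibTriv u).localFrameCoeff_apply_of_mem_baseSet (modelBasis u)
    (I := (𝓡 n).tangent) hw (FiberBundle.extend (Model n) x) i
  rw [FiberBundle.extend_apply_self] at h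
  exact h

theorem frameBasis_self (u : TangentBundle (𝓡 n) M) :
    frameBasis u (mem_fibTriv u) = fibBasis u :=
  Module.Basis.eq_of_apply_eq fun i => frame_self u i

/-! ### Tensoriality and the curvature as a fibrewise trilinear map -/

/-- An operation on locally defined smooth sections that is linear over smooth functions. -/
structure IsTensorialAt {A : Type*} [AddCommGroup A] [Module ℝ A] (Φ : PiField n M → A)
    (u : TangentBundle (𝓡 n) M) : Prop where
  add : ∀ X Y, SmoothNear X u → SmoothNear Y u → Φ (X + Y) = Φ X + Φ Y
  smul : ∀ f X, SmoothFunNear f u → SmoothNear X u → Φ (f • X) = f u • Φ X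
  congr : ∀ X Y, SmoothNear X u → (∀ᶠ w in 𝓝 u, Y w = X w) → Φ Y = Φ X

theorem smoothNear_zero (u : TangentBundle (𝓡 n) M) : SmoothNear 0 u :=
  Eventually.of_forall fun _ => (Bundle.contMDiff_zeroSection ℝ
    (fun w : TangentBundle (𝓡 n) M => Fib w)).contMDiffAt

theorem SmoothNear.sum {ι : Type*} {s : Finset ι} {X : ι → PiField n M}
    (h : ∀ i ∈ s, SmoothNear (X i) u) : SmoothNear (∑ i ∈ s, X i) u := by
  classical
  induction s using Finset.induction_on with
  | empty => exact smoothNear_zero u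
  | insert a s ha ih =>
    rw [Finset.sum_insert ha]
    exact (h a (Finset.mem_insert_self a s)).add
      (ih fun i hi => h i (Finset.mem_insert_of_mem hi))

namespace IsTensorialAt

variable {A : Type*} [AddCommGroup A] [Module ℝ A] {Φ : PiField n M → A}

theorem map_zero (h : IsTensorialAt Φ u) : Φ 0 = 0 := by
  have := h.add 0 0 (smoothNear_zero u) (smoothNear_zero u)
  simpa using this

theorem map_sum (h : IsTensorialAt Φ u) {ι : Type*} {s : Finset ι} {X : ι → PiField n M}
    (hX : ∀ i ∈ s, SmoothNear (X i) u) : Φ (∑ i ∈ s, X i) = ∑ i ∈ s, Φ (X i) := by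
  classical
  induction s using Finset.induction_on with
  | empty => exact h.map_zero
  | insert a s ha ih =>
    have h1 : ∀ i ∈ s, SmoothNear (X i) u := fun i hi => hX i (Finset.mem_insert_of_mem hi)
    rw [Finset.sum_insert ha, Finset.sum_insert ha,
      h.add _ _ (hX a (Finset.mem_insert_self a s)) (SmoothNear.sum h1), ih h1]

/-- Expanding `X` in the frame shows that a tensorial operation sees only the value `X u`, and sees
it linearly. -/
theorem apply_eq_constr (h : IsTensorialAt Φ u) (hX : SmoothNear X u) :
    Φ X = (fibBasis u).constr ℝ (fun i => Φ (frame u i)) (X u) := by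
  have h1 : ∀ i ∈ Finset.univ, SmoothNear ((fun w => frameCoeff u i w (X w)) • frame u i) u :=
    fun i _ => (smoothNear_frame u i).smul (hX.frameCoeff i)
  rw [← h.congr X _ hX ((eventually_eq_sum_frameCoeff u X).mono fun _ h => h.symm),
    h.map_sum h1, Module.Basis.constr_apply_fintype]
  refine Finset.sum_congr rfl fun i _ => ?_
  rw [h.smul _ _ (hX.frameCoeff i) (smoothNear_frame u i), frameCoeff_eq_repr (mem_fibTriv u),
    frameBasis_self, Module.Basis.equivFun_apply]

end IsTensorialAt

theorem isTensorialAt_hCurvature_left [T2Space M] (hD : IsLinearConnection D)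
    (hr : IsRegular D) (hu : u ∈ slit n M)
    (hZ : SmoothNear Z u) :
    IsTensorialAt (fun X => hCurvature D X Y Z u) u where
  add X X' hX hX' := by
    simp only [hCurvature, betaField_add]
    exact curvature_add_left hD hu (hr.vSmoothNear_beta hD hu hX) (hr.vSmoothNear_beta hD hu hX') hZ
  smul f X hf hX := by
    simp only [hCurvature, betaField_smul]
    exact curvature_smul_left hD hu hf (hr.vSmoothNear_beta hD hu hX) hZ
  congr X X' hX h :=
    curvature_congr_left hD hu (hr.vSmoothNear_beta hD hu hX) hZ
      (h.mono fun w hw => congrArg (beta D w) hw)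

/-- Skew-symmetry in the first two slots reduces this to the first slot. -/
theorem isTensorialAt_hCurvature_middle [T2Space M] (hD : IsLinearConnection D)
    (hr : IsRegular D) (hu : u ∈ slit n M)
    (hZ : SmoothNear Z u) :
    IsTensorialAt (fun Y => hCurvature D X Y Z u) u := by
  have h := isTensorialAt_hCurvature_left (Y := X) hD hr hu hZ
  simp only [hCurvature_swap D X] at h
  refine ⟨fun Y Y' hY hY' => ?_, fun f Y hf hY => ?_, fun Y Y' hY hYY' => ?_⟩
  · have := h.add Y Y' hY hY'
    rw [← neg_add] at this
    exact neg_injective this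
  · have := h.smul f Y hf hY
    rw [smul_neg] at this
    exact neg_injective this
  · exact neg_injective (h.congr Y Y' hY hYY')

theorem isTensorialAt_hCurvature_right [T2Space M] (hD : IsLinearConnection D)
    (hr : IsRegular D) (hu : u ∈ slit n M)
    (hX : SmoothNear X u) (hY : SmoothNear Y u) :
    IsTensorialAt (fun Z => hCurvature D X Y Z u) u where
  add _ _ hZ hZ' :=
    curvature_add_right hD hu (hr.vSmoothNear_beta hD hu hX) (hr.vSmoothNear_beta hD hu hY) hZ hZ'
  smul _ _ hf hZ :=
    curvature_smul_right hD hu hf (hr.vSmoothNear_beta hD hu hX) (hr.vSmoothNear_beta hD hu hY) hZ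
  congr _ _ hZ h :=
    curvature_congr_right hD hu (hr.vSmoothNear_beta hD hu hX) (hr.vSmoothNear_beta hD hu hY) hZ h

/-- The h-curvature at `u` as a trilinear map on the fibre. -/
def curvTensor (D : Conn n M) (u : TangentBundle (𝓡 n) M) :
    Fib u →ₗ[ℝ] Fib u →ₗ[ℝ] Fib u →ₗ[ℝ] Fib u :=
  (fibBasis u).constr ℝ fun i => (fibBasis u).constr ℝ fun j => (fibBasis u).constr ℝ fun k =>
    hCurvature D (frame u i) (frame u j) (frame u k) u

theorem hCurvature_eq_curvTensor [T2Space M] (hD : IsLinearConnection D) (hr : IsRegular D)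
    (hu : u ∈ slit n M) (hX : SmoothNear X u) (hY : SmoothNear Y u) (hZ : SmoothNear Z u) :
    hCurvature D X Y Z u = curvTensor D u (X u) (Y u) (Z u) := by
  rw [(isTensorialAt_hCurvature_left hD hr hu hZ).apply_eq_constr hX]
  simp only [(isTensorialAt_hCurvature_middle hD hr hu hZ).apply_eq_constr hY,
    (isTensorialAt_hCurvature_right hD hr hu (smoothNear_frame u _)
      (smoothNear_frame u _)).apply_eq_constr hZ, curvTensor]
  simp only [Module.Basis.constr_apply_fintype, LinearMap.sum_apply, LinearMap.smul_apply]

/-! ### Differentiability of real functions -/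

theorem FunDiffAt.congr (hf : FunDiffAt f u) (h : ∀ᶠ w in 𝓝 u, g w = f w) : FunDiffAt g u :=
  MDifferentiableAt.congr_of_eventuallyEq hf h

theorem funDiffAt_const (c : ℝ) (u : TangentBundle (𝓡 n) M) : FunDiffAt (fun _ => c) u :=
  mdifferentiableAt_const

theorem FunDiffAt.add (hf : FunDiffAt f u) (hg : FunDiffAt g u) :
    FunDiffAt (fun w => f w + g w) u :=
  MDifferentiableAt.add hf hg

theorem FunDiffAt.mul (hf : FunDiffAt f u) (hg : FunDiffAt g u) :
    FunDiffAt (fun w => f w * g w) u :=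
  MDifferentiableAt.mul hf hg

theorem FunDiffAt.sum {ι : Type*} {s : Finset ι} {F : ι → TangentBundle (𝓡 n) M → ℝ}
    (h : ∀ i ∈ s, FunDiffAt (F i) u) : FunDiffAt (fun w => ∑ i ∈ s, F i w) u := by
  classical
  induction s using Finset.induction_on with
  | empty => exact funDiffAt_const 0 u
  | insert a s ha ih =>
    simp only [Finset.sum_insert ha]
    exact (h a (Finset.mem_insert_self a s)).add (ih fun i hi => h i (Finset.mem_insert_of_mem hi))

theorem FunDiffAt.prod {ι : Type*} {s : Finset ι} {F : ι → TangentBundle (𝓡 n) M → ℝ}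
    (h : ∀ i ∈ s, FunDiffAt (F i) u) : FunDiffAt (fun w => ∏ i ∈ s, F i w) u := by
  classical
  induction s using Finset.induction_on with
  | empty => exact funDiffAt_const 1 u
  | insert a s ha ih =>
    simp only [Finset.prod_insert ha]
    exact (h a (Finset.mem_insert_self a s)).mul (ih fun i hi => h i (Finset.mem_insert_of_mem hi))

theorem FunDiffAt.det {A : TangentBundle (𝓡 n) M → Matrix (Fin n) (Fin n) ℝ}
    (h : ∀ i j, FunDiffAt (fun w => A w i j) u) : FunDiffAt (fun w => (A w).det) u := by
  simp only [Matrix.det_apply']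
  exact FunDiffAt.sum fun σ _ => (funDiffAt_const _ u).mul (FunDiffAt.prod fun i _ => h _ i)

theorem FunDiffAt.matrix_inv {A : TangentBundle (𝓡 n) M → Matrix (Fin n) (Fin n) ℝ}
    (h : ∀ i j, FunDiffAt (fun w => A w i j) u) (hu : IsUnit (A u)) (i j : Fin n) :
    FunDiffAt (fun w => (A w)⁻¹ i j) u := by
  -- Cramer's rule holds for every matrix, a singular one giving `0` on both sides. The inverse thus
  -- becomes a quotient of polynomials in the entries.
  have h1 : (fun w => (A w)⁻¹ i j) =
      fun w => ((A w).det)⁻¹ * ((A w).updateRow j (Pi.single i 1)).det := by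
    funext w
    rw [Matrix.inv_def, Matrix.smul_apply, Matrix.adjugate_apply, Ring.inverse_eq_inv', smul_eq_mul]
  rw [h1]
  have hdet : (A u).det ≠ 0 := ((Matrix.isUnit_iff_isUnit_det _).1 hu).ne_zero
  refine FunDiffAt.mul (MDifferentiableAt.inv (FunDiffAt.det h) hdet) (FunDiffAt.det fun k l => ?_)
  by_cases hk : k = j
  · subst hk
    simp only [Matrix.updateRow_self]
    exact funDiffAt_const _ u
  · simp only [Matrix.updateRow_ne hk]
    exact h k l

theorem mvfderiv_congr (h : ∀ᶠ w in 𝓝 u, g w = f w) :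
    mvfderiv (𝓡 n).tangent g u = mvfderiv (𝓡 n).tangent f u := by
  have h' : g =ᶠ[𝓝 u] f := h
  have h2 : g u = f u := h.self_of_nhds
  simp only [mvfderiv]
  rw [h'.mfderiv_eq, h2]

theorem mvfderiv_mul_apply (hf : FunDiffAt f u) (hg : FunDiffAt g u) (v : TT u) :
    mvfderiv (𝓡 n).tangent (fun w => f w * g w) u v =
      mvfderiv (𝓡 n).tangent f u v * g u + f u * mvfderiv (𝓡 n).tangent g u v := by
  have h := DFunLike.congr_fun (mvfderiv_mul hf hg) v
  refine h.trans ?_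
  rw [add_comm, mul_comm]
  rfl

theorem mvfderiv_sum_apply {ι : Type*} {s : Finset ι} {F : ι → TangentBundle (𝓡 n) M → ℝ}
    (h : ∀ i ∈ s, FunDiffAt (F i) u) (v : TT u) :
    mvfderiv (𝓡 n).tangent (fun w => ∑ i ∈ s, F i w) u v =
      ∑ i ∈ s, mvfderiv (𝓡 n).tangent (F i) u v := by
  classical
  induction s using Finset.induction_on with
  | empty =>
    simp only [Finset.sum_empty]
    exact DFunLike.congr_fun (mvfderiv_const (0 : ℝ)) v
  | insert a s ha ih =>
    have h1 : ∀ i ∈ s, FunDiffAt (F i) u := fun i hi => h i (Finset.mem_insert_of_mem hi)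
    simp only [Finset.sum_insert ha]
    rw [← ih h1]
    exact DFunLike.congr_fun (mvfderiv_add (h a (Finset.mem_insert_self a s))
      (FunDiffAt.sum h1)) v

/-! ### Ricci tensor and scalar curvature -/

/-- The metric as a bilinear form in the algebraic sense. -/
def metricForm (L : TangentBundle (𝓡 n) M → ℝ) (u : TangentBundle (𝓡 n) M) :
    Fib u →ₗ[ℝ] Fib u →ₗ[ℝ] ℝ :=
  LinearMap.mk₂ ℝ (fun x y => metric L u x y)
    (fun x x' y => by simp) (fun c x y => by simp) (fun x y y' => by simp) (fun c x y => by simp)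

theorem ricci_eq_ricciForm [T2Space M] (hD : IsLinearConnection D) (hr : IsRegular D)
    (hu : u ∈ slit n M) (hX : SmoothNear X u) (hZ : SmoothNear Z u) :
    ricci D X Z u = ricciForm (curvTensor D u) (X u) (Z u) := by
  rw [ricciForm_eq_sum (fibBasis u)]
  refine Finset.sum_congr rfl fun k _ => ?_
  rw [hCurvature_eq_curvTensor hD hr hu hX (smoothNear_frame u k) hZ, frame_self]
  rfl

theorem scalarCurvature_eq_metricTrace [T2Space M] (hD : IsLinearConnection D) (hr : IsRegular D)
    (hu : u ∈ slit n M) :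
    scalarCurvature L D u =
      metricTrace (fibBasis u) (metricForm L u) (ricciForm (curvTensor D u)) := by
  refine Finset.sum_congr rfl fun i _ => Finset.sum_congr rfl fun j _ => ?_
  rw [ricci_eq_ricciForm hD hr hu (smoothNear_frame u i) (smoothNear_frame u j), frame_self,
    frame_self]
  rfl

/-- The matrix of the metric in the frame around `u`. -/
def gramNear (L : TangentBundle (𝓡 n) M → ℝ) (u w : TangentBundle (𝓡 n) M) :
    Matrix (Fin n) (Fin n) ℝ :=
  Matrix.of fun i j => metric L w (frame u i w) (frame u j w)

/-- The components of the Ricci tensor in the frame around `u`. -/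
def ricciNear (D : Conn n M) (u w : TangentBundle (𝓡 n) M) : Matrix (Fin n) (Fin n) ℝ :=
  Matrix.of fun i j =>
    ∑ k, frameCoeff u k w (hCurvature D (frame u i) (frame u k) (frame u j) w)

theorem ricciNear_eq_ricciForm [T2Space M] (hD : IsLinearConnection D) (hr : IsRegular D)
    {w : TangentBundle (𝓡 n) M} (hw : w ∈ slit n M) (hwu : w ∈ (fibTriv u).baseSet)
    (hF : ∀ i, SmoothNear (frame u i) w) (i j : Fin n) :
    ricciNear D u w i j =
      ricciForm (curvTensor D w) (frameBasis u hwu i) (frameBasis u hwu j) := by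
  rw [ricciForm_eq_sum (frameBasis u hwu), ricciNear, Matrix.of_apply]
  refine Finset.sum_congr rfl fun k _ => ?_
  rw [frameCoeff_eq_repr hwu, hCurvature_eq_curvTensor hD hr hw (hF i) (hF k) (hF j)]
  rfl

/-- By definition each `w` uses its own `fibBasis w`, which need not vary smoothly. Basis
independence replaces it by the single frame around `u`, in which the expression can be
differentiated. -/
theorem eventually_scalarCurvature_eq [T2Space M] (hD : IsLinearConnection D) (hr : IsRegular D)
    (hu : u ∈ slit n M) :
    ∀ᶠ w in 𝓝 u, scalarCurvature L D w =
      ∑ i, ∑ j, (gramNear L u w)⁻¹ i j * ricciNear D u w i j := by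
  have hF : ∀ᶠ w in 𝓝 u, ∀ i, SmoothNear (frame u i) w :=
    eventually_all.2 fun i => (smoothNear_frame u i).eventually
  filter_upwards [slit_mem_nhds hu, eventually_mem_fibTriv u, hF] with w hw hwu hFw
  rw [scalarCurvature_eq_metricTrace hD hr hw, metricTrace_basis_independent _ (frameBasis u hwu)]
  refine Finset.sum_congr rfl fun i _ => Finset.sum_congr rfl fun j _ => ?_
  rw [ricciNear_eq_ricciForm hD hr hw hwu hFw]
  rfl

/-- The endomorphism of the fibre at `u` describing the derivatives of the frame. -/
def frameDeriv (D : Conn n M) (u : TangentBundle (𝓡 n) M) (v : TT u) : Fib u →ₗ[ℝ] Fib u :=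
  (fibBasis u).constr ℝ fun i => D (frame u i) u v

theorem frameDeriv_basis (v : TT u) (i : Fin n) :
    frameDeriv D u v (fibBasis u i) = D (frame u i) u v :=
  (fibBasis u).constr_basis ℝ _ i

/-- Differentiating `X = ∑ cᵢ eᵢ` gives `DX = ∑ dcᵢ eᵢ + ∑ cᵢ Deᵢ`, and the second sum is
`frameDeriv` applied to `X u`. -/
theorem mvfderiv_frameCoeff (hD : IsLinearConnection D) (hu : u ∈ slit n M) (hX : PiDiffAt X u)
    (v : TT u) (k : Fin n) :
    mvfderiv (𝓡 n).tangent (fun w => frameCoeff u k w (X w)) u v =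
      (fibBasis u).repr (D X u v - frameDeriv D u v (X u)) k := by
  have hc : ∀ i, FunDiffAt (fun w => frameCoeff u i w (X w)) u := fun i => hX.frameCoeff i
  have hterm : ∀ i, PiDiffAt ((fun w => frameCoeff u i w (X w)) • frame u i) u := fun i =>
    (smoothNear_frame u i).piDiffAt.smul (hc i)
  have hsum : ∀ s : Finset (Fin n),
      PiDiffAt (∑ i ∈ s, (fun w => frameCoeff u i w (X w)) • frame u i) u ∧
      D (∑ i ∈ s, (fun w => frameCoeff u i w (X w)) • frame u i) u v =
        ∑ i ∈ s, (frameCoeff u i u (X u) • D (frame u i) u v +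
          mvfderiv (𝓡 n).tangent (fun w => frameCoeff u i w (X w)) u v • fibBasis u i) := by
    intro s
    classical
    induction s using Finset.induction_on with
    | empty =>
      refine ⟨(smoothNear_zero u).piDiffAt, ?_⟩
      rw [Finset.sum_empty, Finset.sum_empty]
      exact DFunLike.congr_fun (hD.isCovariantDerivativeOn.zero hu) v
    | insert a s ha ih =>
      rw [Finset.sum_insert ha, Finset.sum_insert ha]
      refine ⟨(hterm a).add ih.1, ?_⟩
      rw [hD.map_add hu (hterm a) ih.1, ← ih.2,
        hD.map_smul hu (hc a) (smoothNear_frame u a).piDiffAt, frame_self]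
      rfl
  have h1 : D X u v = ∑ i, (frameCoeff u i u (X u) • D (frame u i) u v +
      mvfderiv (𝓡 n).tangent (fun w => frameCoeff u i w (X w)) u v • fibBasis u i) := by
    rw [← (hsum Finset.univ).2, ← hD.congr hu hX
      ((eventually_eq_sum_frameCoeff u X).mono fun _ h => h.symm)]
  have h2 : frameDeriv D u v (X u) = ∑ i, frameCoeff u i u (X u) • D (frame u i) u v := by
    rw [frameDeriv, Module.Basis.constr_apply_fintype]
    refine Finset.sum_congr rfl fun i _ => ?_
    rw [frameCoeff_eq_repr (mem_fibTriv u), frameBasis_self, Module.Basis.equivFun_apply]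
  rw [h1, h2, Finset.sum_add_distrib, add_sub_cancel_left, Module.Basis.repr_sum_self]

/-! ### Horizontal derivatives of the curvature and its contractions -/

theorem piDiffAt_hCurvature [T2Space M] (hD : IsLinearConnection D) (hr : IsRegular D)
    (hu : u ∈ slit n M) (hX : SmoothNear X u) (hY : SmoothNear Y u) (hZ : SmoothNear Z u) :
    PiDiffAt (hCurvature D X Y Z) u :=
  piDiffAt_curvature hD hu (hr.vSmoothNear_beta hD hu hX) (hr.vSmoothNear_beta hD hu hY) hZ

theorem hCurvature_eventually_congr [T2Space M] {X' Y' Z' : PiField n M}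
    (hD : IsLinearConnection D) (hr : IsRegular D) (hu : u ∈ slit n M)
    (hX : SmoothNear X u) (hY : SmoothNear Y u) (hZ : SmoothNear Z u)
    (hX' : SmoothNear X' u) (hY' : SmoothNear Y' u) (hZ' : SmoothNear Z' u)
    (eX : ∀ᶠ w in 𝓝 u, X' w = X w) (eY : ∀ᶠ w in 𝓝 u, Y' w = Y w)
    (eZ : ∀ᶠ w in 𝓝 u, Z' w = Z w) :
    ∀ᶠ w in 𝓝 u, hCurvature D X Y Z w = hCurvature D X' Y' Z' w := by
  filter_upwards [slit_mem_nhds hu, hX.eventually, hY.eventually, hZ.eventually, hX'.eventually,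
    hY'.eventually, hZ'.eventually, eX, eY, eZ] with w hw h1 h2 h3 h1' h2' h3' e1 e2 e3
  rw [hCurvature_eq_curvTensor hD hr hw h1 h2 h3, hCurvature_eq_curvTensor hD hr hw h1' h2' h3',
    e1, e2, e3]

set_option maxHeartbeats 1000000 in
/-- The recurrence condition in terms of local sections. -/
theorem along_hCurvature [T2Space M] (hD : IsLinearConnection D) (hr : IsRegular D)
    (hrec : SatisfiesRecurrence D (hCurvature D) lam) (hu : u ∈ slit n M)
    (hW : IsPiVectorField W) (hX : SmoothNear X u) (hY : SmoothNear Y u) (hZ : SmoothNear Z u) :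
    D (hCurvature D X Y Z) u (betaField D W u) =
      lam u (W u) • curvTensor D u (X u) (Y u) (Z u)
        + curvTensor D u (D X u (betaField D W u)) (Y u) (Z u)
        + curvTensor D u (X u) (D Y u (betaField D W u)) (Z u)
        + curvTensor D u (X u) (Y u) (D Z u (betaField D W u)) := by
  -- `hrec` applies to global sections only, so each local section is replaced by a global one with
  -- the same germ at `u`.
  obtain ⟨X', gX, eX⟩ := hX.exists_global
  obtain ⟨Y', gY, eY⟩ := hY.exists_global
  obtain ⟨Z', gZ, eZ⟩ := hZ.exists_global
  have hX' := gX.smoothNear hu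
  have hY' := gY.smoothNear hu
  have hZ' := gZ.smoothNear hu
  have hβ := hr.vSmoothNear_beta hD hu (hW.smoothNear hu)
  have aX : along D (betaField D W) X' u = D X u (betaField D W u) :=
    hD.along_congr hu hX.piDiffAt eX
  have aY : along D (betaField D W) Y' u = D Y u (betaField D W u) :=
    hD.along_congr hu hY.piDiffAt eY
  have aZ : along D (betaField D W) Z' u = D Z u (betaField D W u) :=
    hD.along_congr hu hZ.piDiffAt eZ
  have h0 : D (hCurvature D X Y Z) u (betaField D W u) =
      along D (betaField D W) (hCurvature D X' Y' Z') u :=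
    hD.along_congr hu (piDiffAt_hCurvature hD hr hu hX' hY' hZ')
      (hCurvature_eventually_congr hD hr hu hX hY hZ hX' hY' hZ' eX eY eZ)
  have h1 := hCurvature_eq_curvTensor hD hr hu (hD.smoothNear_along hu hβ hX') hY' hZ'
  have h2 := hCurvature_eq_curvTensor hD hr hu hX' (hD.smoothNear_along hu hβ hY') hZ'
  have h3 := hCurvature_eq_curvTensor hD hr hu hX' hY' (hD.smoothNear_along hu hβ hZ')
  have h4 := hCurvature_eq_curvTensor hD hr hu hX' hY' hZ'
  rw [aX, eY.self_of_nhds, eZ.self_of_nhds] at h1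
  rw [aY, eX.self_of_nhds, eZ.self_of_nhds] at h2
  rw [aZ, eX.self_of_nhds, eY.self_of_nhds] at h3
  rw [eX.self_of_nhds, eY.self_of_nhds, eZ.self_of_nhds] at h4
  rw [h0, ← h1, ← h2, ← h3, ← h4, ← hrec W X' Y' Z' hW gX gY gZ u hu, hDeriv]
  abel

theorem gramNear_self : gramNear L u u =
    LinearMap.toMatrix₂ (fibBasis u) (fibBasis u) (metricForm L u) := by
  ext i j
  rw [LinearMap.toMatrix₂_apply, gramNear, Matrix.of_apply, frame_self, frame_self]
  rfl

theorem gramNear_eq {w : TangentBundle (𝓡 n) M} (hw : w ∈ (fibTriv u).baseSet) :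
    gramNear L u w = LinearMap.toMatrix₂ (frameBasis u hw) (frameBasis u hw) (metricForm L w) := by
  ext i j
  rw [LinearMap.toMatrix₂_apply]
  rfl

theorem IsFinsler.eventually_isUnit_gramNear (hL : IsFinsler L) (hu : u ∈ slit n M) :
    ∀ᶠ w in 𝓝 u, IsUnit (gramNear L u w) := by
  filter_upwards [slit_mem_nhds hu, eventually_mem_fibTriv u] with w hw hwu
  rw [gramNear_eq hwu]
  exact isUnit_gram_of_pos _ _ (hL.posDef w hw)

theorem IsFinsler.funDiffAt_gramNear (hL : IsFinsler L) (hu : u ∈ slit n M) (i j : Fin n) :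
    FunDiffAt (fun w => gramNear L u w i j) u :=
  hL.funDiffAt_metric hu (smoothNear_frame u i).piDiffAt (smoothNear_frame u j).piDiffAt

/-- The matrix of `frameDeriv`, with rows indexed by the argument. -/
def frameDerivMatrix (D : Conn n M) (u : TangentBundle (𝓡 n) M) (v : TT u) :
    Matrix (Fin n) (Fin n) ℝ :=
  (LinearMap.toMatrix (fibBasis u) (fibBasis u) (frameDeriv D u v)).transpose

theorem sum_frameDerivMatrix (v : TT u) (i : Fin n) :
    frameDeriv D u v (fibBasis u i) = ∑ a, frameDerivMatrix D u v i a • fibBasis u a := by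
  simp only [frameDerivMatrix, Matrix.transpose_apply, LinearMap.toMatrix_apply]
  rw [Module.Basis.sum_repr]

/-- The action of the frame derivative on a bilinear form takes the shape `ΩB + BΩᵀ` required by
`sum_inv_mul_deriv`; the transpose in `frameDerivMatrix` is chosen for this. -/
theorem frameDerivMatrix_mul_add (v : TT u) (B : Fib u →ₗ[ℝ] Fib u →ₗ[ℝ] ℝ) (i j : Fin n) :
    B (frameDeriv D u v (fibBasis u i)) (fibBasis u j)
      + B (fibBasis u i) (frameDeriv D u v (fibBasis u j)) =
    (frameDerivMatrix D u v * LinearMap.toMatrix₂ (fibBasis u) (fibBasis u) B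
      + LinearMap.toMatrix₂ (fibBasis u) (fibBasis u) B *
        (frameDerivMatrix D u v).transpose) i j := by
  rw [sum_frameDerivMatrix, sum_frameDerivMatrix]
  simp only [map_sum, map_smul, LinearMap.sum_apply, LinearMap.smul_apply, smul_eq_mul,
    Matrix.add_apply, Matrix.mul_apply, LinearMap.toMatrix₂_apply, Matrix.transpose_apply]
  congr 1
  exact Finset.sum_congr rfl fun a _ => mul_comm _ _

/-- As `g` is parallel, the Gram matrix changes only through the motion of the frame. -/
theorem IsCartanConnection.mvfderiv_gramNear [T2Space M]
    (hD : IsCartanConnection L D) (hu : u ∈ slit n M) (v : TT u) (i j : Fin n) :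
    mvfderiv (𝓡 n).tangent (fun w => gramNear L u w i j) u v =
      (frameDerivMatrix D u v * gramNear L u u
        + gramNear L u u * (frameDerivMatrix D u v).transpose) i j := by
  refine (hD.mvfderiv_metric hu (smoothNear_frame u i) (smoothNear_frame u j) v).trans ?_
  rw [gramNear_self, ← frameDerivMatrix_mul_add, frameDeriv_basis, frameDeriv_basis, frame_self,
    frame_self]
  rfl

theorem ricciNear_self [T2Space M] (hD : IsLinearConnection D) (hr : IsRegular D)
    (hu : u ∈ slit n M) : ricciNear D u u =
      LinearMap.toMatrix₂ (fibBasis u) (fibBasis u) (ricciForm (curvTensor D u)) := by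
  ext i j
  rw [LinearMap.toMatrix₂_apply, ricciNear_eq_ricciForm hD hr hu (mem_fibTriv u)
    (smoothNear_frame u), frameBasis_self]

theorem funDiffAt_ricciNear [T2Space M] (hD : IsLinearConnection D) (hr : IsRegular D)
    (hu : u ∈ slit n M) (i j : Fin n) : FunDiffAt (fun w => ricciNear D u w i j) u :=
  FunDiffAt.sum (s := Finset.univ) fun k _ => (piDiffAt_hCurvature hD hr hu (smoothNear_frame u i)
    (smoothNear_frame u k) (smoothNear_frame u j)).frameCoeff k

-- The frame derivative enters through the three arguments of `R` and through its value. The traced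
-- argument and the value cancel, which leaves the two free slots and the recurrence term.
set_option maxHeartbeats 1000000 in
theorem mvfderiv_ricciNear [T2Space M] (hD : IsLinearConnection D) (hr : IsRegular D)
    (hrec : SatisfiesRecurrence D (hCurvature D) lam) (hu : u ∈ slit n M)
    (hW : IsPiVectorField W) (i j : Fin n) :
    mvfderiv (𝓡 n).tangent (fun w => ricciNear D u w i j) u (betaField D W u) =
      (lam u (W u) • ricciNear D u u
        + (frameDerivMatrix D u (betaField D W u) * ricciNear D u u
          + ricciNear D u u * (frameDerivMatrix D u (betaField D W u)).transpose)) i j := by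
  have hp : ∀ k, PiDiffAt (hCurvature D (frame u i) (frame u k) (frame u j)) u := fun k =>
    piDiffAt_hCurvature hD hr hu (smoothNear_frame u i) (smoothNear_frame u k)
      (smoothNear_frame u j)
  refine (mvfderiv_sum_apply (s := Finset.univ) (fun k _ => (hp k).frameCoeff k) _).trans ?_
  rw [Matrix.add_apply, ricciNear_self hD hr hu, ← frameDerivMatrix_mul_add, Matrix.smul_apply,
    LinearMap.toMatrix₂_apply]
  simp only [ricciForm_eq_sum (fibBasis u), smul_eq_mul]
  have hc := sum_repr_comm (fibBasis u) (curvTensor D u) (frameDeriv D u (betaField D W u))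
    (fibBasis u i) (fibBasis u j)
  have hk : ∀ k, mvfderiv (𝓡 n).tangent (fun w => frameCoeff u k w
        (hCurvature D (frame u i) (frame u k) (frame u j) w)) u (betaField D W u) =
      lam u (W u) * (fibBasis u).repr
          (curvTensor D u (fibBasis u i) (fibBasis u k) (fibBasis u j)) k
        + ((fibBasis u).repr (curvTensor D u (frameDeriv D u (betaField D W u) (fibBasis u i))
            (fibBasis u k) (fibBasis u j)) k
          + (fibBasis u).repr (curvTensor D u (fibBasis u i) (fibBasis u k)
            (frameDeriv D u (betaField D W u) (fibBasis u j))) k)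
        + (fibBasis u).repr (curvTensor D u (fibBasis u i)
            (frameDeriv D u (betaField D W u) (fibBasis u k)) (fibBasis u j)) k
        - (fibBasis u).repr (frameDeriv D u (betaField D W u)
            (curvTensor D u (fibBasis u i) (fibBasis u k) (fibBasis u j))) k := by
    intro k
    rw [mvfderiv_frameCoeff hD hu (hp k), along_hCurvature hD hr hrec hu hW (smoothNear_frame u i)
      (smoothNear_frame u k) (smoothNear_frame u j),
      hCurvature_eq_curvTensor hD hr hu (smoothNear_frame u i) (smoothNear_frame u k)
        (smoothNear_frame u j)]
    simp only [frame_self, ← frameDeriv_basis, map_add, map_sub, map_smul, Finsupp.add_apply,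
      Finsupp.sub_apply, Finsupp.smul_apply, smul_eq_mul]
    ring
  simp only [hk, Finset.sum_add_distrib, Finset.sum_sub_distrib, ← Finset.mul_sum]
  -- `sum_repr_comm` is the cancellation `tr(TΩ) = tr(ΩT)`.
  rw [hc]
  ring

theorem funDiffAt_scalarCurvature [T2Space M] (hL : IsFinsler L) (hD : IsLinearConnection D)
    (hr : IsRegular D) (hu : u ∈ slit n M) : FunDiffAt (scalarCurvature L D) u :=
  FunDiffAt.congr (FunDiffAt.sum fun i _ => FunDiffAt.sum fun j _ =>
    (FunDiffAt.matrix_inv (hL.funDiffAt_gramNear hu)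
      (hL.eventually_isUnit_gramNear hu).self_of_nhds i j).mul (funDiffAt_ricciNear hD hr hu i j))
    (eventually_scalarCurvature_eq hD hr hu)

/-- The scalar curvature of a recurrent manifold is recurrent. -/
theorem IsCartanConnection.mvfderiv_scalarCurvature [T2Space M] (hL : IsFinsler L)
    (hD : IsCartanConnection L D) (hrec : SatisfiesRecurrence D (hCurvature D) lam)
    (hu : u ∈ slit n M) (hW : IsPiVectorField W) :
    mvfderiv (𝓡 n).tangent (scalarCurvature L D) u (betaField D W u) =
      lam u (W u) * scalarCurvature L D u := by
  have hc := hD.isLinearConnection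
  have hr := hD.isRegular
  have hG := hL.funDiffAt_gramNear hu
  have hunit := hL.eventually_isUnit_gramNear hu
  have hH := FunDiffAt.matrix_inv hG hunit.self_of_nhds
  have hB := funDiffAt_ricciNear hc hr hu
  set v := betaField D W u with hv
  have hGH : gramNear L u u * (gramNear L u u)⁻¹ = 1 :=
    Matrix.mul_nonsing_inv _ ((Matrix.isUnit_iff_isUnit_det _).1 hunit.self_of_nhds)
  -- `H'` is the entrywise derivative of the inverse Gram matrix; it is never computed, only
  -- constrained by the side goal below.
  have key := sum_inv_mul_deriv (B := ricciNear D u u) (Ω := frameDerivMatrix D u v)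
    (l := lam u (W u)) (H' := Matrix.of fun i j =>
      mvfderiv (𝓡 n).tangent (fun w => (gramNear L u w)⁻¹ i j) u v) hGH ?_
  · rw [mvfderiv_congr (eventually_scalarCurvature_eq hc hr hu),
      (eventually_scalarCurvature_eq hc hr hu).self_of_nhds, ← key,
      mvfderiv_sum_apply fun i _ => FunDiffAt.sum fun j _ => (hH i j).mul (hB i j)]
    refine Finset.sum_congr rfl fun i _ => ?_
    rw [mvfderiv_sum_apply fun j _ => (hH i j).mul (hB i j)]
    refine Finset.sum_congr rfl fun j _ => ?_
    rw [mvfderiv_mul_apply (hH i j) (hB i j), mvfderiv_ricciNear hc hr hrec hu hW]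
    rfl
  -- The side goal is the derivative of `G⁻¹ G = 1`, an identity valid near `u` because the Gram
  -- matrix stays invertible there.
  · ext i j
    have h1 : ∀ᶠ w in 𝓝 u, ∑ k, (gramNear L u w)⁻¹ i k * gramNear L u w k j =
        (1 : Matrix (Fin n) (Fin n) ℝ) i j := by
      filter_upwards [hunit] with w hw
      rw [← Matrix.mul_apply,
        Matrix.nonsing_inv_mul _ ((Matrix.isUnit_iff_isUnit_det _).1 hw)]
    have h2 := DFunLike.congr_fun (mvfderiv_congr h1) v
    rw [mvfderiv_sum_apply fun k _ => (hH i k).mul (hG k j)] at h2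
    have h3 : mvfderiv (𝓡 n).tangent
        (fun _ : TangentBundle (𝓡 n) M => (1 : Matrix (Fin n) (Fin n) ℝ) i j) u v = 0 :=
      DFunLike.congr_fun (mvfderiv_const _) v
    rw [h3] at h2
    rw [Matrix.add_apply, Matrix.mul_apply, Matrix.mul_apply, ← Finset.sum_add_distrib,
      Matrix.zero_apply, ← h2]
    refine Finset.sum_congr rfl fun k _ => ?_
    rw [mvfderiv_mul_apply (hH i k) (hG k j), hD.mvfderiv_gramNear hu]
    rfl

/-! ### The tensor `G` and the concircular curvature tensor -/

theorem tensorG_eq (X Y Z : PiField n M) : tensorG L X Y Z =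
    (fun w => metric L w (X w) (Z w)) • Y - (fun w => metric L w (Y w) (Z w)) • X := rfl

theorem IsFinsler.piDiffAt_tensorG (hL : IsFinsler L) (hu : u ∈ slit n M) (hX : PiDiffAt X u)
    (hY : PiDiffAt Y u) (hZ : PiDiffAt Z u) : PiDiffAt (tensorG L X Y Z) u :=
  (PiDiffAt.smul (hL.funDiffAt_metric hu hX hZ) hY).sub
    (PiDiffAt.smul (hL.funDiffAt_metric hu hY hZ) hX)

/-- `G` is built algebraically from `g`, so metric compatibility makes it parallel. -/
theorem IsCartanConnection.hDeriv_tensorG [T2Space M] (hL : IsFinsler L)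
    (hD : IsCartanConnection L D) (hu : u ∈ slit n M) (hX : SmoothNear X u)
    (hY : SmoothNear Y u) (hZ : SmoothNear Z u) :
    hDeriv D (tensorG L) W X Y Z u = 0 := by
  have hc := hD.isLinearConnection
  have hXZ := hL.funDiffAt_metric hu hX.piDiffAt hZ.piDiffAt
  have hYZ := hL.funDiffAt_metric hu hY.piDiffAt hZ.piDiffAt
  simp only [hDeriv, along]
  rw [tensorG_eq X Y Z, hc.map_sub hu (hY.piDiffAt.smul hXZ) (hX.piDiffAt.smul hYZ),
    hc.map_smul hu hXZ hY.piDiffAt, hc.map_smul hu hYZ hX.piDiffAt]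
  simp only [sub_apply, add_apply,
    smul_apply, ContinuousLinearMap.smulRight_apply, tensorG, along]
  rw [hD.mvfderiv_metric hu hX hZ, hD.mvfderiv_metric hu hY hZ, add_smul, add_smul]
  abel

theorem IsCartanConnection.satisfiesRecurrence_concircularCurvature [T2Space M] (hL : IsFinsler L)
    (hD : IsCartanConnection L D) (hrec : SatisfiesRecurrence D (hCurvature D) lam) :
    SatisfiesRecurrence D (concircularCurvature L D) lam := by
  intro W X Y Z hW gX gY gZ u hu
  have hc := hD.isLinearConnection
  have hX := gX.smoothNear hu
  have hY := gY.smoothNear hu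
  have hZ := gZ.smoothNear hu
  -- Only the constancy of the factor `(n (n - 1))⁻¹` matters: its product with `r` inherits the
  -- recurrence of `r`.
  have hf : FunDiffAt (fun w => scalarCurvature L D w * ((n : ℝ) * ((n : ℝ) - 1))⁻¹) u :=
    (funDiffAt_scalarCurvature hL hc hD.isRegular hu).mul (funDiffAt_const _ u)
  have hdf : mvfderiv (𝓡 n).tangent
      (fun w => scalarCurvature L D w * ((n : ℝ) * ((n : ℝ) - 1))⁻¹) u (betaField D W u) =
      lam u (W u) * (scalarCurvature L D u * ((n : ℝ) * ((n : ℝ) - 1))⁻¹) := by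
    rw [mvfderiv_mul_apply (funDiffAt_scalarCurvature hL hc hD.isRegular hu) (funDiffAt_const _ u),
      hD.mvfderiv_scalarCurvature hL hrec hu hW]
    have h0 : mvfderiv (𝓡 n).tangent
        (fun _ : TangentBundle (𝓡 n) M => ((n : ℝ) * ((n : ℝ) - 1))⁻¹) u (betaField D W u) = 0 :=
      DFunLike.congr_fun (mvfderiv_const _) _
    rw [h0]
    ring
  have hG := hL.piDiffAt_tensorG hu hX.piDiffAt hY.piDiffAt hZ.piDiffAt
  have hC : concircularCurvature L D X Y Z = hCurvature D X Y Z -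
      (fun w => scalarCurvature L D w * ((n : ℝ) * ((n : ℝ) - 1))⁻¹) • tensorG L X Y Z := rfl
  have h1 := hrec W X Y Z hW gX gY gZ u hu
  have h2 := hD.hDeriv_tensorG (W := W) hL hu hX hY hZ
  simp only [hDeriv] at h1 h2 ⊢
  rw [hC, hc.along_sub hu (piDiffAt_hCurvature hc hD.isRegular hu hX hY hZ) (hG.smul hf),
    hc.along_smul hu hf hG]
  simp only [Pi.add_apply, Pi.sub_apply, Pi.smul_apply', concircularCurvature,
    dirDeriv, div_eq_mul_inv]
  rw [hdf]
  -- Both identities are solved for the covariant derivative of the evaluated tensor, ready to be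
  -- substituted in the product rule.
  rw [sub_sub, sub_sub, sub_eq_iff_eq_add] at h1 h2
  rw [h1, h2]
  module

end Finsler

end

theorem theoremB {n : ℕ} (hn : 3 ≤ n) {M : Type*} [TopologicalSpace M] [T2Space M]
    [ChartedSpace (EuclideanSpace ℝ (Fin n)) M] [IsManifold (𝓡 n) ∞ M]
    (L : TangentBundle (𝓡 n) M → ℝ) (hL : Finsler.IsFinsler L)
    (D : Finsler.Conn n M) (hD : Finsler.IsCartanConnection L D)
    (lam : Finsler.PiForm n M) (hR : Finsler.IsRhRecurrent D lam) :
    Finsler.SatisfiesRecurrence D (Finsler.concircularCurvature L D) lam ∧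
      (¬ Finsler.TensorVanishes (Finsler.concircularCurvature L D) →
        Finsler.IsConcircularlyRecurrent L D lam) :=
  have h := hD.satisfiesRecurrence_concircularCurvature hL hR.recurrence
  ⟨h, fun hC => ⟨hR.form, h, hC⟩⟩
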